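/- Let $n\in\mathbb N$ and $\mathbf x=(x_1,\dots,x_n)\in\mathbb N^n$, where $\mathbb N=\{0,1,2,\dots\}$. **Parking functions.** $\mathrm{PF}(\mathbf x)$ is the set of $\alpha\in\mathbb N^n$ whose weakly increasing rearrangement $\alpha_{i_1}\le\dots\le\alpha_{i_n}$ satisfies $\alpha_{i_j}\le(\sum_{k=1}^j x_k)-1$ for all $1\le j\le n$; and $\mathrm{rsum}(\alpha):=\sum_{i=1}^n(n+1-i)x_i-n-\sum_{i=1}^n\alpha_i$. **Graph.** $G_{\mathbf x}$ is the loopless multigraph on $\{0,1,\dots,n\}$ with root $0$ and $\omega_{G_{\mathbf x}}(\{i,j\})=x_{\min(i,j)+1}$ copies of the edge $\{i,j\}$ for $i\neq j$. **Trees.** For a tree $T$ on $\{0,\dots,n\}$ rooted at $0$, write $i\le_T j$ if the path from $j$ to $0$ passes through $i$, and let $\mathrm{par}_T(j)$ be the parent of $j\ne 0$. $\mathrm{RPT}(n+1)$ is the set of such trees for which (a) $i\le_T j$ implies $i\le j$ for all $1\le i,j\le n$, and (b) $i\le_T k$ implies $i\le_T j$ for all $1\le i<j<k\le n$. $\mathrm{AVO}(T)$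 is the set of total orders $\prec$ on $\{1,\dots,n\}$ such that $j\prec i$ whenever $i<j$ and $\mathrm{par}_T(i)=\mathrm{par}_T(j)$. Put $$\kappa(G_{\mathbf x},T,\prec):=\sum_{\substack{1\le i,j\le n\\ i\le_T j,\ j\prec i}}\omega_{G_{\mathbf x}}(\{\mathrm{par}_T(i),j\}).$$ **Vector DFS-burning algorithm** (input $\alpha\in\mathbb N^n$). Start with a multigraph $G$ on $\{0,\dots,n\}$ whose edges are $x_1$ copies of $\{0,k\}$ for each $k\ge 1$; only $0$ burns, no edge is burnt, $c=0$, $\sigma(0)=0$, $T$ is the single vertex $0$, and the head is $h=0$. Repeat the following scan: run through the non-burning vertices $j$ from the largest to the smallest, and for each of them through the unburnt copies $e$ of $\{h,j\}$ in $G$. If $\alpha_j\ge1$, burn $e$ and decrease $\alpha_j$ by $1$. If $\alpha_j=0$, then $j$ starts to burn: increase $c$ by $1$, set $\sigma(c)=j$, add to $G$ $x_{c+1}$ copies of $\{j,k\}$ for every non-burning $k$, add $j$ and the edge $\{h,j\}$ to $T$, let $\ell(\{h,j\})$ be the number of unburnt copies of $\{h,j\}$ other than $e$, set $h=j$, and start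 a new scan. When a scan is completed: if $h\neq0$, replace $h$ by $\mathrm{par}_T(h)$ and start a new scan; if $h=0$, stop. Finally relabel the vertices of $T$ (and accordingly the edges, with their labels $\ell$) by $i\mapsto\sigma^{-1}(i)$, and let $i\prec j$ if and only if $\sigma(i)<\sigma(j)$. The output is $(T,\ell,\prec)$. **Vector DFS-burning inverse algorithm** (input $T\in\mathrm{RPT}(n+1)$, $\ell\colon E(T)\to\mathbb N$, $\prec\in\mathrm{AVO}(T)$). Start with only $0$ burning, no edge of $G_{\mathbf x}$ burnt, $\beta=(0,\dots,0)$ and head $h=0$. Repeat the following scan: run through the non-burning vertices $j$ from the largest to the smallest with respect to $\prec$, and for each of them through the unburnt copies $e$ of $\{h,j\}$ in $G_{\mathbf x}$. If $\{h,j\}\in E(T)$ and $\ell(\{h,j\})$ equals the number of unburnt copies of $\{h,j\}$ other than $e$, then $j$ starts to burn, set $h=j$, and start a new scan; otherwise burn $e$ and increase $\beta_j$ by $1$. When a scan is completed: if $h\ne0$, replace $h$ by $\mathrm{par}_T(h)$ and start a new scan; if $h=0$, stop. Let $\sigma$ be the permutation with $\sigma(1)\prec\sigma(2)\prec\dots\prec\sigma(n)$.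 The output is $(\beta_{\sigma(1)},\dots,\beta_{\sigma(n)})$. **Theorem.** On every input $\alpha\in\mathrm{PF}(\mathbf x)$ the vector DFS-burning algorithm terminates, and associating to $\alpha$ its output $(T,\ell,\prec)$ defines a bijection $$\psi\colon\mathrm{PF}(\mathbf x)\to\left\{(T,\ell,\prec)\ :\ T\in\mathrm{RPT}(n+1),\ \prec\,\in\mathrm{AVO}(T),\ \ell\colon E(T)\to\mathbb N,\ \ell(e)\in\{0,1,\dots,\omega_{G_{\mathbf x}}(e)-1\}\text{ for all }e\in E(T)\right\}.$$ It satisfies $\mathrm{rsum}(\alpha)=\kappa(G_{\mathbf x},T,\prec)+\sum_{e\in E(T)}\ell(e)$ when $(T,\ell,\prec)=\psi(\alpha)$. On every triple of the right-hand set the vector DFS-burning inverse algorithm terminates, and its output is the image of the triple under $\psi^{-1}$. -/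

import Mathlib

/-! Conventions. The vertex set `{0, 1, …, n}` is `Fin (n + 1)`, with root `0`. The non-root
vertices `1, …, n` are the `i.succ` with `i : Fin n`; sequences indexed by `1, …, n` are functions
on `Fin n`, and a relation on the non-root vertices is a relation on `Fin n`. -/

namespace VectorParking

/-! ### Vector parking functions -/

/-- `α` is an `x`-parking function: its weakly increasing rearrangement `α_{i_1} ≤ ⋯ ≤ α_{i_n}`
satisfies `α_{i_j} ≤ (x_1 + ⋯ + x_j) - 1` (as integers) for all `j`. -/
def IsParking {n : ℕ} (x α : Fin n → ℕ) : Prop :=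
  ∀ j : Fin n, ((α (Tuple.sort α j) : ℕ) : ℤ) ≤ (∑ k ∈ Finset.Iic j, (x k : ℤ)) - 1

/-- The set `PF(x)` of `x`-parking functions. -/
def PF {n : ℕ} (x : Fin n → ℕ) : Set (Fin n → ℕ) := {α | IsParking x α}

/-- The reversed sum `(∑_{i=1}^n (n+1-i) x_i) - n - ∑_i α_i`. With `i : Fin n` standing for the
index `i + 1`, the coefficient is `n - i`. -/
def rsum {n : ℕ} (x α : Fin n → ℕ) : ℤ :=
  (∑ i : Fin n, ((n : ℤ) - (i.val : ℤ)) * (x i : ℤ)) - (n : ℤ) - ∑ i : Fin n, (α i : ℤ)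

/-! ### Multigraphs -/

/-- A loopless multigraph with vertex set `V`, given by its edge-weight function. -/
structure Multigraph (V : Type) where
  /-- the multiplicity of each edge -/
  weight : Sym2 V → ℕ
  /-- there are no loops -/
  weight_loop : ∀ v : V, weight s(v, v) = 0

/-- The multiset of edges: it contains `weight e` copies of each `e`. -/
def Multigraph.edges {V : Type} [Fintype V] [DecidableEq V] (G : Multigraph V) :
    Multiset (Sym2 V) :=
  ∑ e : Sym2 V, Multiset.replicate (G.weight e) e

/-- `next x k` is `x_{k+1}` in the 1-based numbering, for `0 ≤ k < n`. (The value for `k ≥ n` is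
never used: it would be the multiplicity of an edge whose smaller endpoint is the last vertex.) -/
def next {n : ℕ} (x : Fin n → ℕ) (k : ℕ) : ℕ := if h : k < n then x ⟨k, h⟩ else 0

/-- The multigraph `G_x` on `{0, …, n}`, with `x_{min(i,j)+1}` edges between `i` and `j ≠ i`. -/
def Gx {n : ℕ} (x : Fin n → ℕ) : Multigraph (Fin (n + 1)) where
  weight := Sym2.lift ⟨fun i j => if i = j then 0 else next x (min i.val j.val), by
    intro i j
    simp only [eq_comm (a := i) (b := j), min_comm i.val j.val]⟩
  weight_loop := by
    intro v
    simp

/-! ### Rooted trees -/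

/-- The order `i ≤_T j`: the path in `T` from `j` to the root `0` passes through `i`. -/
def TreeLE {n : ℕ} (T : SimpleGraph (Fin (n + 1))) (i j : Fin (n + 1)) : Prop :=
  ∃ p : T.Walk j 0, p.IsPath ∧ i ∈ p.support

/-- `i` is an ancestor of `j`, equivalently `j` is a descendant of `i`. -/
def Ancestor {n : ℕ} (T : SimpleGraph (Fin (n + 1))) (i j : Fin (n + 1)) : Prop :=
  TreeLE T i j ∧ i ≠ j

/-- `i` is the parent of `j`: `j` is a descendant of `i`, and no descendant of `i` is an ancestor
of `j`. -/
def IsParent {n : ℕ} (T : SimpleGraph (Fin (n + 1))) (i j : Fin (n + 1)) : Prop :=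
  Ancestor T i j ∧ ¬ ∃ k, Ancestor T i k ∧ Ancestor T k j

open Classical in
/-- The parent `par_T(j)` of a non-root vertex `j`. (The value at the root is never used.) -/
noncomputable def par {n : ℕ} (T : SimpleGraph (Fin (n + 1))) (j : Fin (n + 1)) : Fin (n + 1) :=
  if h : ∃ i, IsParent T i j then h.choose else 0

/-- `T ∈ RPT(n+1)`: a rooted plane tree, as a tree on `{0, …, n}` labelled in depth-first order. -/
def IsRootedPlaneTree {n : ℕ} (T : SimpleGraph (Fin (n + 1))) : Prop :=
  T.IsTree ∧
  (∀ i j : Fin (n + 1), i ≠ 0 → j ≠ 0 → TreeLE T i j → i ≤ j) ∧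
  (∀ i j k : Fin (n + 1), i ≠ 0 → i < j → j < k → TreeLE T i k → TreeLE T i j)

/-- `≺ ∈ AVO(T)`: a total order on the non-root vertices such that `j ≺ i` whenever `i < j` are
siblings. -/
def IsAdmissibleOrder {n : ℕ} (T : SimpleGraph (Fin (n + 1))) (lt : Fin n → Fin n → Prop) : Prop :=
  IsStrictTotalOrder (Fin n) lt ∧
  ∀ i j : Fin n, i < j → par T i.succ = par T j.succ → lt j i

open Classical in
/-- The number `κ(G, T, ≺)`: the sum of `ω_G({par_T(i), j})` over the pairs of non-root vertices
with `i ≤_T j` and `j ≺ i`. -/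
noncomputable def kappa {n : ℕ} (G : Multigraph (Fin (n + 1))) (T : SimpleGraph (Fin (n + 1)))
    (lt : Fin n → Fin n → Prop) : ℕ :=
  ∑ i : Fin n, ∑ j : Fin n,
    if TreeLE T i.succ j.succ ∧ lt j i then G.weight s(par T i.succ, j.succ) else 0

/-- The data `(T, ℓ, ≺)`: a graph on `{0, …, n}`, a labelling of its edges by natural numbers, and
a relation on the non-root vertices. -/
structure Triple (n : ℕ) where
  /-- the graph `T` -/
  tree : SimpleGraph (Fin (n + 1))
  /-- the edge labelling `ℓ` -/
  label : tree.edgeSet → ℕ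
  /-- the relation `≺` -/
  lt : Fin n → Fin n → Prop

open Classical in
/-- The sum of all edge labels. -/
noncomputable def Triple.labelSum {n : ℕ} (t : Triple n) : ℕ := ∑ e : t.tree.edgeSet, t.label e

/-- The set of triples `(T, ℓ, ≺)` with `T ∈ RPT(n+1)`, `≺ ∈ AVO(T)` and
`ℓ(e) ∈ {0, 1, …, ω_{G_x}(e) - 1}` for every edge `e` of `T`. -/
def Triples {n : ℕ} (x : Fin n → ℕ) : Set (Triple n) :=
  {t | IsRootedPlaneTree t.tree ∧ IsAdmissibleOrder t.tree t.lt ∧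
    ∀ e : t.tree.edgeSet, t.label e < (Gx x).weight e}

/-! ### The algorithms

Each algorithm is a deterministic machine `step : State → Option State`, which halts when `step`
returns `none`; `StateTransition.eval` runs it until it halts. A set of copies of edges, such as
`burnt_edges`, is a multiset of edges. The field `todo` is the program position: it holds the
vertices `j` that the outer loop `for all j ∉ burning_vertices, in order from max to min` has not
finished with. Its maximum is the current `j`, and as long as there is an unburnt copy of
`{head, j}` the inner loop `for all e = {head, j} ∈ E(G) - burnt_edges` continues. -/

open Classical in
/-- The maximum of the finite set `s` with respect to `lt`, or `none` if there is none. -/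
noncomputable def maxOf {n : ℕ} (lt : Fin n → Fin n → Prop) (s : Finset (Fin n)) :
    Option (Fin n) :=
  if h : ∃ j ∈ s, ∀ k ∈ s, k ≠ j → lt k j then some h.choose else none

/-- The vertices that are not burning (the root always burns). -/
def notBurning {n : ℕ} (burning : Finset (Fin (n + 1))) : Finset (Fin n) :=
  Finset.univ.filter fun j => j.succ ∉ burning

/-- The state of the vector DFS-burning algorithm. -/
structure BurnState (n : ℕ) where
  /-- the multiset `E(G)` of edges added so far -/
  edges : Multiset (Sym2 (Fin (n + 1)))
  /-- `burning_vertices`, which is also the vertex set `V(T)` -/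
  burning : Finset (Fin (n + 1))
  /-- `burnt_edges` -/
  burnt : Multiset (Sym2 (Fin (n + 1)))
  /-- `counter`, the number of non-root vertices that burn -/
  counter : ℕ
  /-- the map `σ`, of which only the values at `0, …, counter` have a meaning -/
  perm : ℕ → Fin (n + 1)
  /-- the edges of `T` -/
  tree : SimpleGraph (Fin (n + 1))
  /-- the labelling `ℓ`, of which only the values at the edges of `T` have a meaning -/
  label : Sym2 (Fin (n + 1)) → ℕ
  /-- `head` -/
  head : Fin (n + 1)
  /-- the current value of `α` -/
  chips : Fin n → ℕ
  /-- the vertices that the current run of the outer loop still has to treat -/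
  todo : Finset (Fin n)

/-- The initial state: `0` burns, and `x_1` edges join it to every other vertex. -/
def burnInit {n : ℕ} (x α : Fin n → ℕ) : BurnState n where
  edges := ∑ k : Fin n, Multiset.replicate (next x 0) s(0, k.succ)
  burning := {0}
  burnt := 0
  counter := 0
  perm := fun _ => 0
  tree := ⊥
  label := fun _ => 0
  head := 0
  chips := α
  todo := notBurning {0}

/-- The vertex `j` starts to burn along an edge `{head, j}`. -/
def ignite {n : ℕ} (x : Fin n → ℕ) (s : BurnState n) (j : Fin n) : BurnState n :=
  let e := s(s.head, j.succ)
  let burning := insert j.succ s.burning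
  let counter := s.counter + 1
  let edges := s.edges +
    ∑ k ∈ notBurning burning, Multiset.replicate (next x counter) s(j.succ, k.succ)
  { edges := edges
    burning := burning
    burnt := s.burnt
    counter := counter
    perm := Function.update s.perm counter j.succ
    tree := s.tree ⊔ SimpleGraph.edge s.head j.succ
    label := Function.update s.label e ((edges - (s.burnt + {e})).count e)
    head := j.succ
    chips := s.chips
    todo := notBurning burning }

/-- One step of the vector DFS-burning algorithm. -/
noncomputable def burnStep {n : ℕ} (x : Fin n → ℕ) (s : BurnState n) : Option (BurnState n) :=
  match maxOf (· < ·) s.todo with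
  | some j =>
    if s(s.head, j.succ) ∈ s.edges - s.burnt then
      if 1 ≤ s.chips j then
        some { s with
          burnt := s.burnt + {s(s.head, j.succ)}
          chips := Function.update s.chips j (s.chips j - 1) }
      else some (ignite x s j)
    else some { s with todo := s.todo.erase j }
  | none =>
    if s.head ≠ 0 then
      some { s with head := par s.tree s.head, todo := notBurning s.burning }
    else none

/-- The result of a final state: the vertices of `T` are relabelled by `v ↦ σ⁻¹(v)`, so that
`a, b ∈ {0, …, counter}` are joined in the result if and only if `σ(a), σ(b)` are joined in `T`, and
the relabelled edge `{a, b}` keeps the label of `{σ(a), σ(b)}`; the order is given by `i ≺ j` if and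
only if `σ(i) < σ(j)`. -/
def burnOutput {n : ℕ} (s : BurnState n) : Triple n where
  tree :=
    { Adj := fun a b => a.val ≤ s.counter ∧ b.val ≤ s.counter ∧
        s.tree.Adj (s.perm a.val) (s.perm b.val)
      symm := ⟨fun _ _ h => ⟨h.2.1, h.1, h.2.2.symm⟩⟩
      loopless := ⟨fun _ h => h.2.2.ne rfl⟩ }
  label := fun e => s.label (Sym2.map (fun a : Fin (n + 1) => s.perm a.val) e.val)
  lt := fun i j => i.succ.val ≤ s.counter ∧ j.succ.val ≤ s.counter ∧
    s.perm i.succ.val < s.perm j.succ.val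

/-- The vector DFS-burning algorithm with respect to `x`, on input `α`. -/
noncomputable def vectorDFS {n : ℕ} (x α : Fin n → ℕ) : Part (Triple n) :=
  (StateTransition.eval (burnStep x) (burnInit x α)).map burnOutput

/-- The state of the multigraph DFS-burning inverse algorithm. -/
structure UnburnState (n : ℕ) where
  /-- `burning_vertices` -/
  burning : Finset (Fin (n + 1))
  /-- `burnt_edges` -/
  burnt : Multiset (Sym2 (Fin (n + 1)))
  /-- the current value of `α` -/
  chips : Fin n → ℕ
  /-- `head` -/
  head : Fin (n + 1)
  /-- the vertices that the current run of the outer loop still has to treat -/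
  todo : Finset (Fin n)

/-- The initial state: only `0` burns, and there are no chips. -/
def unburnInit (n : ℕ) : UnburnState n where
  burning := {0}
  burnt := 0
  chips := fun _ => 0
  head := 0
  todo := notBurning {0}

open Classical in
/-- One step of the multigraph DFS-burning inverse algorithm on input `(T, ℓ)`, with respect to the
multigraph `G` and the order `≺`, where `t = (T, ℓ, ≺)`. -/
noncomputable def unburnStep {n : ℕ} (G : Multigraph (Fin (n + 1))) (t : Triple n)
    (s : UnburnState n) : Option (UnburnState n) :=
  match maxOf t.lt s.todo with
  | some j =>
    if s(s.head, j.succ) ∈ G.edges - s.burnt then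
      if ∃ h : s(s.head, j.succ) ∈ t.tree.edgeSet, t.label ⟨s(s.head, j.succ), h⟩ =
          (G.edges - (s.burnt + {s(s.head, j.succ)})).count s(s.head, j.succ) then
        some { s with
          burning := insert j.succ s.burning
          head := j.succ
          todo := notBurning (insert j.succ s.burning) }
      else
        some { s with
          burnt := s.burnt + {s(s.head, j.succ)}
          chips := Function.update s.chips j (s.chips j + 1) }
    else some { s with todo := s.todo.erase j }
  | none =>
    if s.head ≠ 0 then
      some { s with head := par t.tree s.head, todo := notBurning s.burning }
    else none

/-- The multigraph DFS-burning inverse algorithm. -/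
noncomputable def multigraphInverse {n : ℕ} (G : Multigraph (Fin (n + 1))) (t : Triple n) :
    Part (Fin n → ℕ) :=
  (StateTransition.eval (unburnStep G t) (unburnInit n)).map fun s => s.chips

open Classical in
/-- The permutation `σ` with `σ(1) ≺ σ(2) ≺ ⋯ ≺ σ(n)`; it exists and is unique if `≺` is a total
order. -/
noncomputable def sortPerm {n : ℕ} (lt : Fin n → Fin n → Prop) : Equiv.Perm (Fin n) :=
  if h : ∃ σ : Equiv.Perm (Fin n), ∀ i j : Fin n, i < j → lt (σ i) (σ j) then h.choose else 1

/-- The vector DFS-burning inverse algorithm with respect to `x`: if `β` is the result of the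
multigraph inverse algorithm for `G_x` and `≺`, the output is `(β_{σ(1)}, …, β_{σ(n)})`. -/
noncomputable def vectorInverse {n : ℕ} (x : Fin n → ℕ) (t : Triple n) : Part (Fin n → ℕ) :=
  (multigraphInverse (Gx x) t).map fun β => β ∘ sortPerm t.lt

end VectorParking

/-! Number the vertices by the time at which they ignite, so that the tree becomes a parent function
`p` with `p k < k`. Everything rests on a count made when the `k`-th vertex `j` ignites. It has then
been offered x_1 + ⋯ + x_k edges, x_{a+1} of them by the burning vertex number `a < k`. A vertex off
the path from the head to the root was left only after all its edges to `j` were burnt. A vertex on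
that path, other than the head, is suspended at its child `i` on the path; as scans run downwards,
its edges to `j` are all burnt if `j` is larger than `i` in the original names, and all intact if
`j` is smaller. The head contributes burnt edges, the igniting edge, and as many unburnt ones as the
label says. Since α_j edges are burnt in all, α_j + 1 + (label of the edge above `k`) + (terms of κ
with second index `k`) = x_1 + ⋯ + x_k. This is `Encodes`; it comes from `BurnInv` through
`sum_eq_of_burnt`.

The triple alone fixes every term except α_j, so the output determines α (`Encodes.unique`).
Dropping terms leaves α_j < x_1 + ⋯ + x_k with `k` running through a permutation, so α is parking
(`Encodes.isParking`). Summing over `k` gives the formula for rsum. Conversely, if the fire died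
with only c < n non-root vertices burning, every other entry would be at least x_1 + ⋯ + x_{c+1},
leaving at most c smaller entries where the parking condition requires c + 1
(`BurnInv.counter_eq_of_isParking`).

Surjectivity is a simulation (`Mirror`). Let α be the output of the inverse algorithm on a triple,
and run the burning algorithm on α beside it. The two could differ only in whether an edge burns or
ignites: one machine consults the label, the other the remaining chips. The chips of a vertex are
frozen once it ignites, so the remaining chips at `j` count the edges that the inverse algorithm has
yet to burn towards it, and vanish exactly when it ignites. That the inverse algorithm ignites 1, …,
n in this order follows from condition (b) on the tree and from the sibling condition on ≺
(`UnburnInv.val_eq_of_ignites`). -/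

namespace VectorParking

/-! ### Ancestors with respect to a parent function -/

/-- `Anc p i k`: the number `i` is obtained from `k` by iterating the parent function `p`, stopping
at `0` at the latest. -/
inductive Anc (p : ℕ → ℕ) (i : ℕ) : ℕ → Prop
  | refl : Anc p i i
  | step {k : ℕ} : 0 < k → Anc p i (p k) → Anc p i k

lemma anc_iff {p : ℕ → ℕ} {i k : ℕ} : Anc p i k ↔ i = k ∨ 0 < k ∧ Anc p i (p k) := by
  constructor
  · rintro (_ | ⟨h, h'⟩)
    · exact Or.inl rfl
    · exact Or.inr ⟨h, h'⟩
  · rintro (rfl | ⟨h, h'⟩)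
    · exact Anc.refl
    · exact Anc.step h h'

lemma Anc.eq_zero {p : ℕ → ℕ} {i : ℕ} (h : Anc p i 0) : i = 0 := by
  rcases anc_iff.1 h with h | h
  · exact h
  · exact absurd h.1 (lt_irrefl _)

lemma Anc.trans {p : ℕ → ℕ} {i j k : ℕ} (h : Anc p i j) (h' : Anc p j k) : Anc p i k := by
  induction h' with
  | refl => exact h
  | step h0 _ ih => exact Anc.step h0 ih

lemma anc_parent {p : ℕ → ℕ} {k : ℕ} (hk : 0 < k) : Anc p (p k) k := Anc.step hk Anc.refl

lemma Anc.le {p : ℕ → ℕ} (hp : ∀ k, 0 < k → p k < k) {i k : ℕ} (h : Anc p i k) : i ≤ k := by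
  induction h with
  | refl => exact le_rfl
  | step h0 _ ih => exact ih.trans (hp _ h0).le

lemma anc_root {p : ℕ → ℕ} (hp : ∀ k, 0 < k → p k < k) (k : ℕ) : Anc p 0 k := by
  induction k using Nat.strong_induction_on with
  | _ k ih =>
    rcases Nat.eq_zero_or_pos k with rfl | hk
    · exact Anc.refl
    · exact Anc.step hk (ih _ (hp k hk))

/-- A proper ancestor of `k` is the parent of an ancestor of `k`. -/
lemma Anc.exists_child {p : ℕ → ℕ} {i k : ℕ} (h : Anc p i k) (hne : i ≠ k) :
    ∃ l, 0 < l ∧ Anc p l k ∧ p l = i := by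
  induction h with
  | refl => exact absurd rfl hne
  | @step k h0 h' ih =>
    by_cases hi : i = p k
    · exact ⟨k, h0, Anc.refl, hi.symm⟩
    · obtain ⟨l, hl, hlk, hpl⟩ := ih hi
      exact ⟨l, hl, Anc.step h0 hlk, hpl⟩

lemma Anc.total {p : ℕ → ℕ} {i j k : ℕ} (h : Anc p i k) (h' : Anc p j k) : Anc p i j ∨ Anc p j i := by
  induction h with
  | refl => exact Or.inr h'
  | @step k h0 hi ih =>
    rcases anc_iff.1 h' with rfl | h'
    · exact Or.inl (Anc.step h0 hi)
    · exact ih h'.2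

/-- The ancestors of `k` form a chain along which parents strictly decrease. Hence a path to the
root enters each vertex through a single child, which makes the inner sum in `sum_eq_of_burnt` a
single term. -/
lemma Anc.eq_of_parent_eq {p : ℕ → ℕ} (hp : ∀ k, 0 < k → p k < k) {i j k : ℕ}
    (hi : Anc p i k) (hj : Anc p j k) (hi0 : 0 < i) (hj0 : 0 < j)
    (h : p i = p j) : i = j := by
  by_contra hne
  rcases hi.total hj with h' | h'
  · rcases anc_iff.1 h' with h'' | h''
    · exact hne h''
    · have := (h''.2).le hp
      have := hp i hi0
      omega
  · rcases anc_iff.1 h' with h'' | h''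
    · exact hne h''.symm
    · have := (h''.2).le hp
      have := hp j hj0
      omega

/-- The relation `Anc` below `c` depends only on the values of the parent function below `c`. -/
lemma anc_congr {p q : ℕ → ℕ} (hp : ∀ k, 0 < k → p k < k) {c : ℕ} (h : ∀ k ≤ c, p k = q k)
    {i k : ℕ} (hk : k ≤ c) : Anc p i k ↔ Anc q i k := by
  induction k using Nat.strong_induction_on with
  | _ k ih =>
    rw [anc_iff, anc_iff (p := q), ← h k hk]
    refine or_congr Iff.rfl (and_congr_right fun h0 => ?_)
    exact ih _ (hp k h0) ((hp k h0).le.trans hk)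

/-! ### Graphs given by a parent function -/

/-- The graph `T` is the rooted tree on the distinct vertices `σ 0 = 0, σ 1, …, σ c` in which the
parent of `σ k` is `σ (p k)`; the other vertices are isolated. -/
structure IsRooted {n : ℕ} (T : SimpleGraph (Fin (n + 1))) (c : ℕ) (σ : ℕ → Fin (n + 1))
    (p : ℕ → ℕ) : Prop where
  zero : σ 0 = 0
  inj : ∀ a ≤ c, ∀ b ≤ c, σ a = σ b → a = b
  lt : ∀ k, 0 < k → p k < k
  adj : ∀ u v, T.Adj u v ↔ ∃ k, 0 < k ∧ k ≤ c ∧ (u = σ k ∧ v = σ (p k) ∨ u = σ (p k) ∧ v = σ k)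

namespace IsRooted

variable {n : ℕ} {T : SimpleGraph (Fin (n + 1))} {c : ℕ} {σ : ℕ → Fin (n + 1)} {p : ℕ → ℕ}

lemma adj_parent (h : IsRooted T c σ p) {k : ℕ} (h0 : 0 < k) (hk : k ≤ c) :
    T.Adj (σ k) (σ (p k)) :=
  (h.adj _ _).2 ⟨k, h0, hk, Or.inl ⟨rfl, rfl⟩⟩

/-- A neighbour of `σ k` is its parent or one of its children. -/
lemma adj_cases (h : IsRooted T c σ p) {k : ℕ} (hk : k ≤ c) {v : Fin (n + 1)}
    (hv : T.Adj (σ k) v) :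
    (0 < k ∧ v = σ (p k)) ∨ ∃ l, 0 < l ∧ l ≤ c ∧ p l = k ∧ v = σ l := by
  obtain ⟨l, l0, lc, ⟨h1, h2⟩ | ⟨h1, h2⟩⟩ := (h.adj _ _).1 hv
  · have := h.inj k hk l lc h1
    subst this
    exact Or.inl ⟨l0, h2⟩
  · have := h.inj k hk (p l) ((h.lt l l0).le.trans lc) h1
    exact Or.inr ⟨l, l0, lc, this.symm, h2⟩

lemma adj_iff (h : IsRooted T c σ p) {a b : ℕ} (hab : a < b) (hb : b ≤ c) :
    T.Adj (σ a) (σ b) ↔ p b = a := by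
  constructor
  · intro hadj
    rcases h.adj_cases (hab.le.trans hb) hadj with ⟨a0, h1⟩ | ⟨l, l0, lc, hl, h1⟩
    · have h2 := h.lt a a0
      have := h.inj b hb (p a) (by omega) h1
      omega
    · have := h.inj b hb l lc h1
      subst this
      exact hl
  · rintro rfl
    exact (h.adj_parent (by omega) hb).symm

/-- A step of the walk goes to the parent or to a child, and ancestors other than the current vertex
survive both moves; the walk ends at the root, so it meets them all. The walk need not be a path,
which is what excludes descents in `exists_anc_of_mem_support`. -/
lemma anc_mem_support (h : IsRooted T c σ p) {u w : Fin (n + 1)} (q : T.Walk u w) (hw : w = 0)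
    {k : ℕ} (hk : k ≤ c) (hu : u = σ k) {i : ℕ} (hi : Anc p i k) : σ i ∈ q.support := by
  induction q generalizing k i with
  | nil =>
    have := h.inj k hk 0 (Nat.zero_le _) (by rw [← hu, hw, h.zero])
    subst this
    simp [hi.eq_zero, hw, h.zero]
  | @cons u v w hadj q ih =>
    subst hu
    rw [SimpleGraph.Walk.support_cons, List.mem_cons]
    rcases h.adj_cases hk hadj with ⟨k0, hv⟩ | ⟨l, l0, lc, hl, hv⟩
    · rcases anc_iff.1 hi with rfl | ⟨_, hi⟩
      · exact Or.inl rfl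
      · exact Or.inr (ih hw ((h.lt k k0).le.trans hk) hv hi)
    · exact Or.inr (ih hw lc hv (Anc.step l0 (hl ▸ hi)))

lemma exists_anc_of_mem_support (h : IsRooted T c σ p) {u w : Fin (n + 1)} (q : T.Walk u w)
    (hq : q.IsPath) (hw : w = 0) {k : ℕ} (hk : k ≤ c) (hu : u = σ k) {v : Fin (n + 1)}
    (hv : v ∈ q.support) : ∃ i, Anc p i k ∧ v = σ i := by
  induction q generalizing k v with
  | nil =>
    simp only [SimpleGraph.Walk.support_nil, List.mem_singleton] at hv
    exact ⟨k, Anc.refl, hv.trans hu⟩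
  | @cons u y w hadj q ih =>
    subst hu
    rw [SimpleGraph.Walk.cons_isPath_iff] at hq
    rw [SimpleGraph.Walk.support_cons, List.mem_cons] at hv
    rcases hv with rfl | hv
    · exact ⟨k, Anc.refl, rfl⟩
    rcases h.adj_cases hk hadj with ⟨k0, hy⟩ | ⟨l, l0, lc, hl, hy⟩
    · obtain ⟨i, hi, hvi⟩ := ih hq.1 hw ((h.lt k k0).le.trans hk) hy hv
      exact ⟨i, Anc.step k0 hi, hvi⟩
    -- A path to the root cannot step down to a child `l`: its remainder would meet `σ k`, an
    -- ancestor of `l`, again.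
    · exact absurd (h.anc_mem_support q hw lc hy (hl ▸ anc_parent l0)) hq.2

lemma reachable_root (h : IsRooted T c σ p) {k : ℕ} (hk : k ≤ c) : T.Reachable (σ k) 0 := by
  induction k using Nat.strong_induction_on with
  | _ k ih =>
    rcases Nat.eq_zero_or_pos k with rfl | k0
    · rw [h.zero]
    · exact (h.adj_parent k0 hk).reachable.trans (ih _ (h.lt k k0) ((h.lt k k0).le.trans hk))

lemma treeLE_iff_exists (h : IsRooted T c σ p) {k : ℕ} (hk : k ≤ c) {v : Fin (n + 1)} :
    TreeLE T v (σ k) ↔ ∃ i, Anc p i k ∧ v = σ i := by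
  constructor
  · rintro ⟨q, hq, hv⟩
    exact h.exists_anc_of_mem_support q hq rfl hk rfl hv
  · rintro ⟨i, hi, rfl⟩
    obtain ⟨q⟩ := h.reachable_root hk
    classical
    exact ⟨q.toPath, q.toPath.2, h.anc_mem_support _ rfl hk rfl hi⟩

lemma treeLE_iff (h : IsRooted T c σ p) {i k : ℕ} (hi : i ≤ c) (hk : k ≤ c) :
    TreeLE T (σ i) (σ k) ↔ Anc p i k := by
  rw [h.treeLE_iff_exists hk]
  constructor
  · rintro ⟨j, hj, hij⟩
    rwa [h.inj i hi j ((hj.le h.lt).trans hk) hij]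
  · exact fun h' => ⟨i, h', rfl⟩

lemma ancestor_iff (h : IsRooted T c σ p) {k : ℕ} (hk : k ≤ c) {v : Fin (n + 1)} :
    Ancestor T v (σ k) ↔ ∃ i, Anc p i k ∧ i ≠ k ∧ v = σ i := by
  rw [Ancestor, h.treeLE_iff_exists hk]
  constructor
  · rintro ⟨⟨i, hi, rfl⟩, hne⟩
    exact ⟨i, hi, fun h' => hne (h' ▸ rfl), rfl⟩
  · rintro ⟨i, hi, hne, rfl⟩
    exact ⟨⟨i, hi, rfl⟩, fun h' => hne (h.inj _ ((hi.le h.lt).trans hk) _ hk h')⟩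

lemma isParent_iff (h : IsRooted T c σ p) {k : ℕ} (k0 : 0 < k) (hk : k ≤ c) {v : Fin (n + 1)} :
    IsParent T v (σ k) ↔ v = σ (p k) := by
  have hlt := h.lt k k0
  constructor
  · rintro ⟨hv, hno⟩
    obtain ⟨i, hi, hik, rfl⟩ := (h.ancestor_iff hk).1 hv
    rcases anc_iff.1 hi with rfl | ⟨_, hi⟩
    · exact absurd rfl hik
    · by_contra hne
      exact hno ⟨σ (p k), (h.ancestor_iff (by omega)).2 ⟨i, hi, fun h' => hne (h' ▸ rfl), rfl⟩,
        (h.ancestor_iff hk).2 ⟨p k, anc_parent k0, hlt.ne, rfl⟩⟩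
  · rintro rfl
    refine ⟨(h.ancestor_iff hk).2 ⟨p k, anc_parent k0, hlt.ne, rfl⟩, ?_⟩
    rintro ⟨w, hw1, hw2⟩
    obtain ⟨i, hi, hik, rfl⟩ := (h.ancestor_iff hk).1 hw2
    have hic := (hi.le h.lt).trans hk
    obtain ⟨l, hl, hli, hlk⟩ := (h.ancestor_iff hic).1 hw1
    rcases anc_iff.1 hi with rfl | ⟨_, hi⟩
    · exact hik rfl
    · have h1 := hi.le h.lt
      have h2 := hl.le h.lt
      have := h.inj (p k) (by omega) l (by omega) hlk
      omega

lemma par_eq (h : IsRooted T c σ p) {k : ℕ} (k0 : 0 < k) (hk : k ≤ c) :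
    par T (σ k) = σ (p k) := by
  have hex : ∃ i, IsParent T i (σ k) := ⟨_, (h.isParent_iff k0 hk).2 rfl⟩
  rw [par, dif_pos hex]
  exact (h.isParent_iff k0 hk).1 hex.choose_spec

end IsRooted

/-! ### Trees on `{0, …, n}` -/

/-- The vertex `k` of `{0, …, n}`. -/
abbrev vert (n : ℕ) (k : ℕ) : Fin (n + 1) := Fin.ofNat (n + 1) k

lemma vert_val {n : ℕ} (a : Fin (n + 1)) : vert n a.val = a := by
  ext
  simp

lemma val_vert {n k : ℕ} (hk : k ≤ n) : (vert n k).val = k := by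
  simp [Nat.mod_eq_of_lt (Nat.lt_succ_of_le hk)]

lemma vert_succ {n : ℕ} (j : Fin n) : vert n (j.val + 1) = j.succ := by
  rw [← Fin.val_succ, vert_val]

lemma vert_zero (n : ℕ) : vert n 0 = 0 := by
  ext; simp

lemma vert_inj {n a b : ℕ} (ha : a ≤ n) (hb : b ≤ n) (h : vert n a = vert n b) : a = b := by
  rw [← val_vert ha, ← val_vert hb, h]

section

variable {n : ℕ} {T : SimpleGraph (Fin (n + 1))} {p : ℕ → ℕ}

/-- The preorder property of a parent function on `{0, …, c}`. -/
def IsPreorder (c : ℕ) (p : ℕ → ℕ) : Prop :=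
  ∀ i j k, 0 < i → i < j → j < k → k ≤ c → Anc p i k → Anc p i j

/-- The edge from a non-root vertex to its parent. -/
def parentEdge (n : ℕ) (p : ℕ → ℕ) (j : Fin n) : Sym2 (Fin (n + 1)) :=
  s(vert n (p (j.val + 1)), j.succ)

lemma IsRooted.parentEdge_mem (h : IsRooted T n (vert n) p) (j : Fin n) :
    parentEdge n p j ∈ T.edgeSet := by
  have := (h.adj_parent (Nat.succ_pos j.val) j.isLt).symm
  rwa [vert_succ] at this

/-- Every edge is named by its endpoint farther from the root, and `p k < k` prevents naming it from
both ends. This yields the edge count in `isTree` and the reindexing in `labelSum_eq`. -/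
lemma IsRooted.parentEdge_bijective (h : IsRooted T n (vert n) p) :
    Function.Bijective fun j : Fin n => (⟨parentEdge n p j, h.parentEdge_mem j⟩ : T.edgeSet) := by
  constructor
  · intro i j hij
    have hij := Subtype.ext_iff.1 hij
    simp only [parentEdge, Sym2.eq_iff] at hij
    have hi := h.lt (i.val + 1) (Nat.succ_pos _)
    have hj := h.lt (j.val + 1) (Nat.succ_pos _)
    rcases hij with hij | ⟨h1, h2⟩
    · exact Fin.succ_injective _ hij.2
    · have h1 := congrArg Fin.val h1
      have h2 := congrArg Fin.val h2
      rw [val_vert (by omega), Fin.val_succ] at h1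
      rw [val_vert (by omega), Fin.val_succ] at h2
      omega
  · rintro ⟨e, he⟩
    induction e using Sym2.ind with
    | _ u v =>
      obtain ⟨k, k0, kn, hk⟩ := (h.adj _ _).1 he
      refine ⟨⟨k - 1, by omega⟩, Subtype.ext ?_⟩
      have h1 : k - 1 + 1 = k := by omega
      have h2 : (⟨k - 1, by omega⟩ : Fin n).succ = vert n k := by
        rw [← vert_succ]; simp [h1]
      simp only [parentEdge, h1, h2]
      rcases hk with ⟨rfl, rfl⟩ | ⟨rfl, rfl⟩
      · exact Sym2.eq_swap
      · rfl

lemma IsRooted.isTree (h : IsRooted T n (vert n) p) : T.IsTree := by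
  rw [SimpleGraph.isTree_iff_connected_and_card]
  constructor
  · refine (SimpleGraph.connected_iff_exists_forall_reachable T).2 ⟨0, fun v => ?_⟩
    rw [← vert_val v]
    exact (h.reachable_root (Nat.le_of_lt_succ v.isLt)).symm
  · rw [← Nat.card_congr (Equiv.ofBijective _ h.parentEdge_bijective)]
    simp

lemma IsRooted.isRootedPlaneTree (h : IsRooted T n (vert n) p) (hpre : IsPreorder n p) :
    IsRootedPlaneTree T := by
  have key : ∀ i j : Fin (n + 1), TreeLE T i j ↔ Anc p i.val j.val := by
    intro i j
    rw [← h.treeLE_iff (Nat.le_of_lt_succ i.isLt) (Nat.le_of_lt_succ j.isLt), vert_val, vert_val]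
  refine ⟨h.isTree, fun i j _ _ hij => ((key i j).1 hij).le h.lt, fun i j k hi hij hjk hik => ?_⟩
  refine (key i j).2 (hpre _ _ _ (Fin.pos_of_ne_zero hi) hij hjk (Nat.le_of_lt_succ k.isLt)
    ((key i k).1 hik))

/-- The parent is the second vertex on the unique path to `0`. Condition (a) makes it smaller than
its child, and condition (b) becomes the preorder property. -/
lemma IsRootedPlaneTree.exists_isRooted (hT : IsRootedPlaneTree T) :
    ∃ p, IsRooted T n (vert n) p ∧ IsPreorder n p := by
  obtain ⟨htree, hle, hpre⟩ := hT
  have huniq := htree.existsUnique_path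
  choose q hq hq' using fun a : Fin (n + 1) => huniq a 0
  -- By uniqueness of paths, either the path from `b` begins with the edge to `a`, or prefixing that
  -- edge to the path from `b` gives the path from `a`.
  have hadj : ∀ a b, T.Adj a b → (a ≠ 0 ∧ (q a).snd = b) ∨ (b ≠ 0 ∧ (q b).snd = a) := by
    intro a b hab
    by_cases hb : a ∈ (q b).support
    · right
      have hpath : q b = (SimpleGraph.Walk.cons hab.symm ((q b).dropUntil a hb)) := by
        have h1 : (q b).takeUntil a hb = SimpleGraph.Walk.cons hab.symm SimpleGraph.Walk.nil := by
          refine (huniq b a).unique ((hq b).takeUntil hb) ?_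
          simp [hab.ne']
        conv_lhs => rw [← (q b).take_spec hb, h1]
        rfl
      refine ⟨?_, by rw [hpath, SimpleGraph.Walk.snd_cons]⟩
      rintro rfl
      have := hq' 0 SimpleGraph.Walk.nil (by simp)
      rw [← this] at hb
      simp at hb
      exact hab.ne hb
    · left
      have hpath : q a = (SimpleGraph.Walk.cons hab (q b)) :=
        (hq' a _ ((SimpleGraph.Walk.cons_isPath_iff _ _).2 ⟨hq b, hb⟩)).symm
      refine ⟨?_, by rw [hpath, SimpleGraph.Walk.snd_cons]⟩
      rintro rfl
      exact hb (SimpleGraph.Walk.end_mem_support _)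
  have hsnd : ∀ a, a ≠ 0 → T.Adj a (q a).snd := fun a ha =>
    SimpleGraph.Walk.adj_snd (SimpleGraph.Walk.not_nil_of_ne ha)
  have hlt : ∀ a, a ≠ 0 → (q a).snd < a := by
    intro a ha
    by_cases h0 : (q a).snd = 0
    · rw [h0]; exact Fin.pos_of_ne_zero ha
    · exact lt_of_le_of_ne (hle _ _ h0 ha ⟨q a, hq a, SimpleGraph.Walk.getVert_mem_support _ _⟩)
        (hsnd a ha).ne'
  -- The value `0` beyond `n` keeps `p k < k` true for every positive `k`.
  have hroot : IsRooted T n (vert n) fun k => if k ≤ n then ((q (vert n k)).snd).val else 0 := by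
    refine ⟨vert_zero n, fun a ha b hb => vert_inj ha hb, fun k k0 => ?_, fun u v => ?_⟩
    · split_ifs with hk
      · have := hlt (vert n k) (fun h => by
          have := congrArg Fin.val h
          rw [val_vert hk] at this
          simp at this
          omega)
        rwa [Fin.lt_def, val_vert hk] at this
      · exact k0
    · constructor
      · intro huv
        rcases hadj u v huv with ⟨h0, h1⟩ | ⟨h0, h1⟩
        · refine ⟨u.val, Fin.pos_of_ne_zero h0, Nat.le_of_lt_succ u.isLt, Or.inl ?_⟩
          rw [if_pos (Nat.le_of_lt_succ u.isLt), vert_val, vert_val, h1]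
          exact ⟨rfl, rfl⟩
        · refine ⟨v.val, Fin.pos_of_ne_zero h0, Nat.le_of_lt_succ v.isLt, Or.inr ?_⟩
          rw [if_pos (Nat.le_of_lt_succ v.isLt), vert_val, vert_val, h1]
          exact ⟨rfl, rfl⟩
      · rintro ⟨k, k0, kn, h⟩
        have hk0 : vert n k ≠ 0 := fun h => by
          have := congrArg Fin.val h
          rw [val_vert kn] at this
          simp at this
          omega
        rw [if_pos kn, vert_val] at h
        rcases h with ⟨rfl, rfl⟩ | ⟨rfl, rfl⟩
        · exact hsnd _ hk0
        · exact (hsnd _ hk0).symm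
  refine ⟨_, hroot, fun i j k i0 hij hjk hkn hik => ?_⟩
  rw [← hroot.treeLE_iff (by omega) (by omega)] at hik ⊢
  refine hpre _ _ _ ?_ ?_ ?_ hik
  · intro h
    have := congrArg Fin.val h
    rw [val_vert (by omega)] at this
    simp at this
    omega
  · rw [Fin.lt_def, val_vert (by omega), val_vert (by omega)]; exact hij
  · rw [Fin.lt_def, val_vert (by omega), val_vert (by omega)]; exact hjk

end

/-! ### Runs of deterministic machines -/

/-- A machine whose states satisfy an invariant (with auxiliary data) under which a measure
decreases in each step reaches a halting state, and this state satisfies the invariant. -/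
lemma exists_halting {S Γ M : Type*} [LT M] [WellFoundedLT M] (f : S → Option S)
    (Inv : S → Γ → Prop) (μ : S → Γ → M)
    (hstep : ∀ s g, Inv s g → f s = none ∨ ∃ s' g', f s = some s' ∧ Inv s' g' ∧ μ s' g' < μ s g)
    (s : S) (g : Γ) (hs : Inv s g) :
    ∃ s' g', StateTransition.Reaches f s s' ∧ f s' = none ∧ Inv s' g' := by
  induction hm : μ s g using WellFoundedLT.induction generalizing s g with
  | _ m ih =>
    rcases hstep s g hs with h | ⟨s', g', h, hi, hlt⟩
    · exact ⟨s, g, Relation.ReflTransGen.refl, h, hs⟩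
    · obtain ⟨s'', g'', h1, h2, h3⟩ := ih _ (hm ▸ hlt) s' g' hi rfl
      exact ⟨s'', g'', Relation.ReflTransGen.head h h1, h2, h3⟩

/-- A run that ends in a halting state passes through the successor of its first state. -/
lemma reaches_of_step {S : Type*} {f : S → Option S} {s s' t : S}
    (h : StateTransition.Reaches f s t) (ht : f t = none) (hs : f s = some s') :
    StateTransition.Reaches f s' t := by
  rcases Relation.ReflTransGen.cases_head h with rfl | ⟨u, hu, h⟩
  · rw [ht] at hs; exact absurd hs (by simp)
  · have : u = s' := by
      have hu : f s = some u := hu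
      rw [hs] at hu
      exact (Option.some.inj hu).symm
    exact this ▸ h

lemma eval_eq_some {S : Type*} {f : S → Option S} {s t : S}
    (h : StateTransition.Reaches f s t) (ht : f t = none) :
    StateTransition.eval f s = Part.some t :=
  Part.eq_some_iff.2 (StateTransition.mem_eval.2 ⟨h, ht⟩)

/-! ### Maxima, multiplicities -/

lemma maxOf_eq_some {n : ℕ} {lt : Fin n → Fin n → Prop} [IsStrictTotalOrder (Fin n) lt]
    {s : Finset (Fin n)} {j : Fin n} :
    maxOf lt s = some j ↔ j ∈ s ∧ ∀ k ∈ s, k ≠ j → lt k j := by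
  unfold maxOf
  constructor
  · intro h
    split_ifs at h with hex
    rw [Option.some.injEq] at h
    rw [← h]
    exact hex.choose_spec
  · intro h
    have hex : ∃ j ∈ s, ∀ k ∈ s, k ≠ j → lt k j := ⟨j, h⟩
    rw [dif_pos hex, Option.some.injEq]
    by_contra hne
    exact asymm (h.2 _ hex.choose_spec.1 hne) (hex.choose_spec.2 _ h.1 (Ne.symm hne))

lemma exists_last {V : Type*} (lt : V → V → Prop) [IsStrictTotalOrder V lt] {s : Finset V}
    (hs : s.Nonempty) : ∃ j ∈ s, ∀ k ∈ s, k ≠ j → lt k j := by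
  classical
  let _ := linearOrderOfSTO lt
  exact ⟨s.max' hs, s.max'_mem _, fun k hk hkj => lt_of_le_of_ne (s.le_max' k hk) hkj⟩

lemma maxOf_eq_none {n : ℕ} {lt : Fin n → Fin n → Prop} [IsStrictTotalOrder (Fin n) lt]
    {s : Finset (Fin n)} : maxOf lt s = none ↔ s = ∅ := by
  constructor
  · intro h
    by_contra hne
    obtain ⟨j, hj⟩ := Finset.nonempty_iff_ne_empty.2 hne
    obtain ⟨m, hm⟩ := exists_last lt ⟨j, hj⟩
    rw [maxOf_eq_some.2 hm] at h
    exact absurd h (by simp)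
  · rintro rfl
    simp [maxOf]

lemma mem_notBurning {n : ℕ} {B : Finset (Fin (n + 1))} {j : Fin n} :
    j ∈ notBurning B ↔ j.succ ∉ B := by
  simp [notBurning]

lemma edge_eq_iff {V : Type*} {B : Finset V} {u v a b : V} (hu : u ∈ B) (hb : b ∉ B) :
    s(u, a) = s(v, b) ↔ u = v ∧ a = b := by
  rw [Sym2.eq_iff, or_iff_left]
  rintro ⟨rfl, _⟩
  exact hb hu

lemma edge_ne {V : Type*} {B : Finset V} {u v a b : V} (hu : u ∈ B) (ha : a ∉ B) (hb : b ∉ B) :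
    s(a, b) ≠ s(u, v) := by
  rw [Ne, Sym2.eq_iff]
  rintro (⟨rfl, _⟩ | ⟨_, rfl⟩)
  · exact ha hu
  · exact hb hu

lemma count_star {n : ℕ} (S : Finset (Fin n)) (m : ℕ) (u : Fin (n + 1)) {k : Fin n} (hk : k ∈ S) :
    (∑ k ∈ S, Multiset.replicate m s(u, k.succ)).count s(u, k.succ) = m := by
  rw [Multiset.count_sum', Finset.sum_eq_single k]
  · simp
  · intro l _ hl
    rw [Multiset.count_replicate, if_neg]
    rw [Sym2.congr_right]
    exact fun h => hl (Fin.succ_injective _ h)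
  · exact fun h => absurd hk h

lemma count_star_of_ne {n : ℕ} (S : Finset (Fin n)) (m : ℕ) {u v w : Fin (n + 1)} (hv : v ≠ u)
    (hw : w ≠ u) : (∑ k ∈ S, Multiset.replicate m s(u, k.succ)).count s(v, w) = 0 := by
  rw [Multiset.count_sum', Finset.sum_eq_zero]
  intro l _
  rw [Multiset.count_replicate, if_neg]
  rw [Sym2.eq_iff]
  rintro (⟨h, _⟩ | ⟨h, _⟩)
  · exact hv h.symm
  · exact hw h.symm

lemma mem_sub_iff_count_lt {V : Type*} [DecidableEq V] {A B : Multiset V} {e : V} :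
    e ∈ A - B ↔ B.count e < A.count e := by
  rw [← Multiset.count_pos, Multiset.count_sub]
  omega

lemma card_sub_add_singleton_lt {V : Type*} [DecidableEq V] {A B : Multiset V} {e : V}
    (h : e ∈ A - B) : (A - (B + {e})).card < (A - B).card := by
  rw [tsub_add_eq_tsub_tsub, Multiset.sub_singleton]
  exact Multiset.card_erase_lt_of_mem h

lemma Gx_weight {n : ℕ} (x : Fin n → ℕ) {a b : ℕ} (hab : a < b) (hb : b ≤ n) :
    (Gx x).weight s(vert n a, vert n b) = next x a := by
  have hne : vert n a ≠ vert n b := fun h => hab.ne (vert_inj (hab.le.trans hb) hb h)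
  simp only [Gx, Sym2.lift_mk, if_neg hne, val_vert (hab.le.trans hb), val_vert hb, min_eq_left hab.le]

lemma count_edges {n : ℕ} (G : Multigraph (Fin (n + 1))) (e : Sym2 (Fin (n + 1))) :
    G.edges.count e = G.weight e := by
  rw [Multigraph.edges, Multiset.count_sum', Finset.sum_eq_single e]
  · simp
  · intro f _ hf
    rw [Multiset.count_replicate, if_neg hf]
  · exact fun h => absurd (Finset.mem_univ e) h

/-! ### The invariant of the burning algorithm -/

/-- The number of burnt copies of the edge between the `a`-th burning vertex and `j`. -/
def BurnState.burntCount {n : ℕ} (s : BurnState n) (a : ℕ) (j : Fin n) : ℕ :=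
  s.burnt.count s(s.perm a, j.succ)

open Classical in
/-- The invariant of the burning algorithm on the input `α`. Burning vertices are numbered in the
order in which they start to burn: `h` is the number of the head, and `p` is the parent function
of the tree in this numbering. -/
structure BurnInv {n : ℕ} (x α : Fin n → ℕ) (s : BurnState n) (h : ℕ) (p : ℕ → ℕ) : Prop where
  counter_le : s.counter ≤ n
  rooted : IsRooted s.tree s.counter s.perm p
  mem_burning : ∀ v, v ∈ s.burning ↔ ∃ k ≤ s.counter, s.perm k = v
  h_le : h ≤ s.counter
  head : s.head = s.perm h
  todo : ∀ j ∈ s.todo, j.succ ∉ s.burning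
  edges : ∀ a ≤ s.counter, ∀ j : Fin n, j.succ ∉ s.burning →
    s.edges.count s(s.perm a, j.succ) = next x a
  edges_zero : ∀ v w, v ∉ s.burning → w ∉ s.burning → s.edges.count s(v, w) = 0
  burnt_zero : ∀ v w, v ∉ s.burning → w ∉ s.burning → s.burnt.count s(v, w) = 0
  burnt_le : ∀ a ≤ s.counter, ∀ j : Fin n, j.succ ∉ s.burning → s.burntCount a j ≤ next x a
  chips : ∀ j : Fin n, j.succ ∉ s.burning →
    s.chips j + ∑ a ∈ Finset.range (s.counter + 1), s.burntCount a j = α j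
  dfs : ∀ i, 0 < i → Anc p i h → ∀ j, i ≤ j → j ≤ s.counter → Anc p i j
  preorder : IsPreorder s.counter p
  -- Scans run downwards: when `i` ignited, its parent had already exhausted its edges to every
  -- larger `j`.
  sibling_full : ∀ i, 0 < i → i ≤ s.counter → ∀ j : Fin n, j.succ ∉ s.burning →
    s.perm i < j.succ → s.burntCount (p i) j = next x (p i)
  -- The scan of `p i` is suspended at `i` while the head lies below `i`, so it has not reached
  -- smaller vertices.
  anc_zero : ∀ i, 0 < i → Anc p i h → ∀ j : Fin n, j.succ ∉ s.burning →
    j.succ < s.perm i → s.burntCount (p i) j = 0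
  done_full : ∀ a ≤ s.counter, ¬ Anc p a h → ∀ j : Fin n, j.succ ∉ s.burning →
    s.burntCount a j = next x a
  todo_full : ∀ j : Fin n, j.succ ∉ s.burning → j ∉ s.todo → s.burntCount h j = next x h
  -- After the return from a child, the scan restarts at the top and meets vertices larger than that
  -- child, whose edges are already burnt; hence the second alternative.
  todo_fresh : ∀ j : Fin n, j.succ ∉ s.burning → ∀ k ∈ s.todo, j < k → s.burntCount h j = 0 ∨
    ∃ i, 0 < i ∧ i ≤ s.counter ∧ p i = h ∧ s.perm i < j.succ
  order : ∀ i k, 0 < i → i < k → k ≤ s.counter → p i = p k → s.perm k < s.perm i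
  label_lt : ∀ k, 0 < k → k ≤ s.counter → s.label s(s.perm (p k), s.perm k) < next x (p k)
  -- The right side counts the edges offered to `j`; the left sorts them into burnt, igniting,
  -- labelled, and untouched ones. The terms `i = 0` and `i = k` vanish, because `s.perm 0 = 0` is
  -- minimal and `<` is strict.
  spec : ∀ k, 0 < k → k ≤ s.counter → ∀ j : Fin n, s.perm k = j.succ →
    α j + 1 + s.label s(s.perm (p k), s.perm k) +
      ∑ i ∈ Finset.range (k + 1), (if Anc p i k ∧ s.perm k < s.perm i then next x (p i) else 0) =
    ∑ a ∈ Finset.range k, next x a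

/-! ### Steps of the burning algorithm that ignite nothing. -/

namespace BurnInv

variable {n : ℕ} {x α : Fin n → ℕ} {s : BurnState n} {h : ℕ} {p : ℕ → ℕ}

lemma init (x α : Fin n → ℕ) {p : ℕ → ℕ} (hp : ∀ k, 0 < k → p k < k) :
    BurnInv x α (burnInit x α) 0 p where
  counter_le := Nat.zero_le _
  rooted := by
    refine ⟨rfl, fun a ha b hb _ => ?_, hp, fun u v => ?_⟩
    · simp only [burnInit] at ha hb; omega
    · simp only [burnInit, SimpleGraph.bot_adj, false_iff]
      rintro ⟨k, k0, kc, _⟩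
      omega
  mem_burning := fun v => by simp [burnInit, eq_comm]
  h_le := le_rfl
  head := rfl
  todo := fun j hj => mem_notBurning.1 hj
  edges := by
    intro a ha j _
    have : a = 0 := by simpa [burnInit] using ha
    subst this
    exact count_star Finset.univ (next x 0) 0 (Finset.mem_univ j)
  edges_zero := by
    intro v w hv hw
    simp only [burnInit, Finset.mem_singleton] at hv hw
    exact count_star_of_ne Finset.univ (next x 0) hv hw
  burnt_zero := fun v w _ _ => by simp [burnInit]
  burnt_le := fun a _ j _ => by simp [burnInit, BurnState.burntCount]
  chips := fun j _ => by simp [burnInit, BurnState.burntCount]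
  dfs := fun i i0 hi => absurd hi.eq_zero i0.ne'
  preorder := fun i j k i0 hij hjk hk => by simp only [burnInit] at hk; omega
  sibling_full := fun i i0 hi => by simp only [burnInit] at hi; omega
  anc_zero := fun i i0 hi => absurd hi.eq_zero i0.ne'
  done_full := by
    intro a ha hna
    have : a = 0 := by simpa [burnInit] using ha
    exact absurd (this ▸ Anc.refl) hna
  todo_full := fun j hj hj' => absurd (mem_notBurning.2 hj) hj'
  todo_fresh := fun j _ k _ _ => Or.inl (by simp [burnInit, BurnState.burntCount])
  order := fun i k i0 hik hk => by simp only [burnInit] at hk; omega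
  label_lt := fun k k0 hk => by simp only [burnInit] at hk; omega
  spec := fun k k0 hk => by simp only [burnInit] at hk; omega

lemma perm_mem (H : BurnInv x α s h p) {a : ℕ} (ha : a ≤ s.counter) : s.perm a ∈ s.burning :=
  (H.mem_burning _).2 ⟨a, ha, rfl⟩

lemma perm_ne (H : BurnInv x α s h p) {a : ℕ} (ha : a ≤ s.counter) {v : Fin (n + 1)}
    (hv : v ∉ s.burning) : s.perm a ≠ v :=
  fun h' => hv (h' ▸ H.perm_mem ha)

lemma parent_le (H : BurnInv x α s h p) {k : ℕ} (k0 : 0 < k) (hk : k ≤ s.counter) :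
    p k ≤ s.counter := (H.rooted.lt k k0).le.trans hk

lemma available_iff (H : BurnInv x α s h p) {j : Fin n} (hj : j.succ ∉ s.burning) :
    s(s.head, j.succ) ∈ s.edges - s.burnt ↔ s.burntCount h j < next x h := by
  rw [mem_sub_iff_count_lt, H.head, H.edges h H.h_le j hj, BurnState.burntCount]

lemma counter_lt (H : BurnInv x α s h p) {j : Fin n} (hj : j.succ ∉ s.burning) :
    s.counter + 1 ≤ n := by
  classical
  have hsub : insert j.succ ((Finset.range (s.counter + 1)).image s.perm) ⊆ Finset.univ :=
    Finset.subset_univ _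
  have hcard := Finset.card_le_card hsub
  rw [Finset.card_insert_of_notMem, Finset.card_image_of_injOn, Finset.card_range, Finset.card_univ,
    Fintype.card_fin] at hcard
  · omega
  · intro a ha b hb hab
    simp only [Finset.coe_range, Set.mem_Iio] at ha hb
    exact H.rooted.inj a (by omega) b (by omega) hab
  · rw [Finset.mem_image]
    rintro ⟨a, ha, hab⟩
    rw [Finset.mem_range] at ha
    exact H.perm_ne (by omega) hj hab

open Classical in
/-- The invariant involves only the values `p k` with `k ≤ counter`. -/
lemma congr_parent (H : BurnInv x α s h p) {q : ℕ → ℕ} (hq : ∀ k, 0 < k → q k < k)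
    (hpq : ∀ k ≤ s.counter, p k = q k) : BurnInv x α s h q := by
  have hanc : ∀ i k, k ≤ s.counter → (Anc p i k ↔ Anc q i k) := fun i k hk =>
    anc_congr H.rooted.lt hpq hk
  refine { H with
    rooted := ⟨H.rooted.zero, H.rooted.inj, hq, fun u v => ?_⟩, dfs := ?_, preorder := ?_,
    sibling_full := ?_, anc_zero := ?_, done_full := ?_, todo_fresh := ?_, order := ?_,
    label_lt := ?_, spec := ?_ }
  · rw [H.rooted.adj]
    refine exists_congr fun k => and_congr_right fun _ => and_congr_right fun hk => ?_
    rw [hpq k hk]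
  · intro i i0 hi j hij hj
    exact (hanc _ _ hj).1 (H.dfs i i0 ((hanc _ _ H.h_le).2 hi) j hij hj)
  · intro i j k i0 hij hjk hk hik
    exact (hanc _ _ (by omega)).1 (H.preorder i j k i0 hij hjk hk ((hanc _ _ hk).2 hik))
  · intro i i0 hi j hj hij
    rw [← hpq i hi]
    exact H.sibling_full i i0 hi j hj hij
  · intro i i0 hi j hj hij
    rw [← hpq i ((hi.le hq).trans H.h_le)]
    exact H.anc_zero i i0 ((hanc _ _ H.h_le).2 hi) j hj hij
  · intro a ha hna
    exact H.done_full a ha fun h' => hna ((hanc _ _ H.h_le).1 h')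
  · intro j hj k hk hjk
    refine (H.todo_fresh j hj k hk hjk).imp id ?_
    rintro ⟨i, i0, hi, hpi, hij⟩
    exact ⟨i, i0, hi, hpq i hi ▸ hpi, hij⟩
  · intro i k i0 hik hk hp
    rw [← hpq i (by omega), ← hpq k hk] at hp
    exact H.order i k i0 hik hk hp
  · intro k k0 hk
    rw [← hpq k hk]
    exact H.label_lt k k0 hk
  · intro k k0 hk j hj
    rw [← H.spec k k0 hk j hj, hpq k hk]
    congr 1
    refine Finset.sum_congr rfl fun i hi => ?_
    rw [Finset.mem_range] at hi
    rw [hpq i (by omega)]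
    exact if_congr (and_congr (hanc i k hk).symm Iff.rfl) rfl rfl

/-- Finding no unburnt edge to the current vertex preserves the invariant. -/
lemma erase (H : BurnInv x α s h p) {j : Fin n} (hj : j ∈ s.todo)
    (hav : s(s.head, j.succ) ∉ s.edges - s.burnt) :
    BurnInv x α { s with todo := s.todo.erase j } h p := by
  refine { H with todo := ?_, todo_full := ?_, todo_fresh := ?_ }
  · exact fun k hk => H.todo k (Finset.mem_of_mem_erase hk)
  · intro k hk hk'
    by_cases hkj : k = j
    · subst hkj
      rw [H.available_iff hk, not_lt] at hav
      exact le_antisymm (H.burnt_le h H.h_le k hk) hav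
    · exact H.todo_full k hk fun h' => hk' (Finset.mem_erase.2 ⟨hkj, h'⟩)
  · exact fun k hk l hl => H.todo_fresh k hk l (Finset.mem_of_mem_erase hl)

/-- Returning to the parent preserves the invariant. -/
lemma backtrack (H : BurnInv x α s h p) (htodo : s.todo = ∅) (h0 : 0 < h) :
    BurnInv x α { s with head := par s.tree s.head, todo := notBurning s.burning } (p h) p := by
  have hanc : ∀ {i}, Anc p i (p h) → Anc p i h := fun hi => Anc.step h0 hi
  refine { H with h_le := ?_, head := ?_, todo := ?_, dfs := ?_, anc_zero := ?_, done_full := ?_,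
                  todo_full := ?_, todo_fresh := ?_ }
  · exact H.parent_le h0 H.h_le
  · change par s.tree s.head = s.perm (p h)
    rw [H.head, H.rooted.par_eq h0 H.h_le]
  · exact fun j hj => mem_notBurning.1 hj
  · exact fun i i0 hi => H.dfs i i0 (hanc hi)
  · exact fun i i0 hi => H.anc_zero i i0 (hanc hi)
  · intro a ha hna j hj
    by_cases hah : a = h
    · subst hah
      exact H.todo_full j hj (by simp [htodo])
    · refine H.done_full a ha (fun h' => hna ?_) j hj
      rcases anc_iff.1 h' with h' | h'
      · exact absurd h' hah
      · exact h'.2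
  · exact fun j hj hj' => absurd (mem_notBurning.2 hj) hj'
  · intro j hj _ _ _
    -- The vertex `h` just left is a burning child of the new head: it witnesses the second
    -- alternative for larger `j`, and smaller `j` are still untouched.
    rcases lt_or_gt_of_ne (H.perm_ne H.h_le hj) with hlt | hlt
    · exact Or.inr ⟨h, h0, H.h_le, rfl, hlt⟩
    · exact Or.inl (H.anc_zero h h0 Anc.refl j hj hlt)

/-- Burning an edge preserves the invariant. -/
lemma burn (H : BurnInv x α s h p) {j : Fin n} (hj : j ∈ s.todo)
    (hmax : ∀ k ∈ s.todo, k ≠ j → k < j) (hav : s(s.head, j.succ) ∈ s.edges - s.burnt)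
    (hchips : 1 ≤ s.chips j) :
    BurnInv x α { s with
          burnt := s.burnt + {s(s.head, j.succ)}
          chips := Function.update s.chips j (s.chips j - 1) } h p := by
  set s' : BurnState n := { s with
          burnt := s.burnt + {s(s.head, j.succ)}
          chips := Function.update s.chips j (s.chips j - 1) } with hs'
  have hjB := H.todo j hj
  rw [H.available_iff hjB] at hav
  have hcount : ∀ a ≤ s.counter, ∀ k : Fin n, k.succ ∉ s.burning →
      s'.burntCount a k = s.burntCount a k + if a = h ∧ k = j then 1 else 0 := by
    intro a ha k hk
    simp only [BurnState.burntCount, hs', Multiset.count_add, Multiset.count_singleton, H.head]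
    congr 1
    refine if_congr ?_ rfl rfl
    rw [edge_eq_iff (H.perm_mem ha) hjB]
    refine and_congr ⟨fun h' => H.rooted.inj a ha h H.h_le h', fun h' => h' ▸ rfl⟩
      ⟨fun h' => Fin.succ_injective _ h', fun h' => h' ▸ rfl⟩
  have hsame : ∀ a ≤ s.counter, ∀ k : Fin n, k.succ ∉ s.burning → ¬ (a = h ∧ k = j) →
      s'.burntCount a k = s.burntCount a k := by
    intro a ha k hk hne
    rw [hcount a ha k hk, if_neg hne, add_zero]
  refine { H with burnt_zero := ?_, burnt_le := ?_, chips := ?_, sibling_full := ?_,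
                  anc_zero := ?_, done_full := ?_, todo_full := ?_, todo_fresh := ?_ }
  · intro v w hv hw
    change (s.burnt + {s(s.head, j.succ)}).count s(v, w) = 0
    rw [Multiset.count_add, H.burnt_zero v w hv hw, Multiset.count_singleton, H.head,
      if_neg (edge_ne (H.perm_mem H.h_le) hv hw)]
  · intro a ha k hk
    rw [hcount a ha k hk]
    split_ifs with hak
    · obtain ⟨rfl, rfl⟩ := hak
      exact hav
    · exact H.burnt_le a ha k hk
  · intro k hk
    change Function.update s.chips j (s.chips j - 1) k +
      ∑ a ∈ Finset.range (s.counter + 1), s'.burntCount a k = α k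
    rw [← H.chips k hk]
    have hsum : ∑ a ∈ Finset.range (s.counter + 1), s'.burntCount a k =
        ∑ a ∈ Finset.range (s.counter + 1), s.burntCount a k + if k = j then 1 else 0 := by
      rw [Finset.sum_congr rfl fun a ha => hcount a (by rw [Finset.mem_range] at ha; omega) k hk,
        Finset.sum_add_distrib]
      congr 1
      have hh := H.h_le
      by_cases hkj : k = j
      · simp [hkj]; omega
      · simp [hkj]
    rw [hsum]
    by_cases hkj : k = j
    · subst hkj
      rw [Function.update_self, if_pos rfl]
      omega
    · rw [Function.update_of_ne hkj, if_neg hkj, add_zero]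
  · intro i i0 hi k hk hik
    rw [hsame (p i) (H.parent_le i0 hi) k hk]
    · exact H.sibling_full i i0 hi k hk hik
    -- Here `j` would exceed a burning child of the head, so its edges would be exhausted, although
    -- one is available.
    · rintro ⟨h1, rfl⟩
      have := H.sibling_full i i0 hi k hk hik
      rw [h1] at this
      omega
  · intro i i0 hi k hk hik
    have hih := hi.le H.rooted.lt
    have hlt := H.rooted.lt i i0
    rw [hsame (p i) (H.parent_le i0 (hih.trans H.h_le)) k hk (by omega)]
    exact H.anc_zero i i0 hi k hk hik
  · intro a ha hna k hk
    rw [hsame a ha k hk (fun h' => hna (h'.1 ▸ Anc.refl))]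
    exact H.done_full a ha hna k hk
  · intro k hk hk'
    rw [hsame h H.h_le k hk (fun h' => hk' (h'.2 ▸ hj))]
    exact H.todo_full k hk hk'
  · intro k hk l hl hkl
    have hlj : l ≤ j := by
      by_cases hlj : l = j
      · exact hlj.le
      · exact (hmax l hl hlj).le
    rw [hsame h H.h_le k hk (fun h' => (hkl.trans_le hlj).ne h'.2)]
    exact H.todo_fresh k hk l hl hkl

end BurnInv

open Classical in
/-- If exactly `1 + l` of the available edges between the head and a vertex are not burnt, and the
edges from the other burning vertices are burnt as a depth-first search does it, then the number of
unburnt edges is determined by the ancestors of the head. -/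
lemma sum_eq_of_burnt {c h l : ℕ} {p b w : ℕ → ℕ} {C : ℕ → Prop} [DecidablePred C]
    (hp : ∀ k, 0 < k → p k < k)
    (hc : h ≤ c) (hC : ¬ C 0) (hhead : b h + (1 + l) = w h)
    (hdone : ∀ a ≤ c, ¬ Anc p a h → b a = w a)
    (hzero : ∀ i, 0 < i → Anc p i h → C i → b (p i) = 0)
    (hfull : ∀ i, 0 < i → Anc p i h → ¬ C i → b (p i) = w (p i)) :
    ∑ a ∈ Finset.range (c + 1), w a = ∑ a ∈ Finset.range (c + 1), b a + (1 + l) +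
      ∑ i ∈ Finset.range (c + 1), if Anc p i h ∧ C i then w (p i) else 0 := by
  have hpos : ∀ i, C i → 0 < i := fun i hi => Nat.pos_of_ne_zero fun h0 => hC (h0 ▸ hi)
  -- The unburnt part `w a - b a` is `1 + l` at the head, all of `w a` where the path goes through a
  -- child of `a` satisfying `C`, and zero elsewhere. The inner sum has at most one nonzero term,
  -- that child.
  have hpoint : ∀ a ∈ Finset.range (c + 1), w a = b a + (if a = h then 1 + l else 0) +
      ∑ i ∈ Finset.range (c + 1), if p i = a ∧ Anc p i h ∧ C i then w a else 0 := by
    intro a ha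
    rw [Finset.mem_range] at ha
    by_cases hah : Anc p a h
    · by_cases heq : a = h
      · subst heq
        rw [if_pos rfl, hhead, Finset.sum_eq_zero, add_zero]
        intro i _
        rw [if_neg]
        rintro ⟨h1, h2, h3⟩
        have := hp i (hpos i h3)
        have := h2.le hp
        omega
      · obtain ⟨i, i0, hi, rfl⟩ := hah.exists_child heq
        have hih := hi.le hp
        rw [if_neg heq, add_zero, Finset.sum_eq_single i]
        · by_cases hCi : C i
          · rw [if_pos ⟨rfl, hi, hCi⟩, hzero i i0 hi hCi, zero_add]
          · rw [if_neg (fun h' => hCi h'.2.2), hfull i i0 hi hCi, add_zero]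
        · intro k _ hk
          rw [if_neg]
          rintro ⟨h1, h2, h3⟩
          exact hk (Anc.eq_of_parent_eq hp h2 hi (hpos k h3) i0 h1)
        · intro h'
          rw [Finset.mem_range] at h'
          omega
    · have heq : a ≠ h := fun h' => hah (h' ▸ Anc.refl)
      rw [if_neg heq, hdone a (by omega) hah, Finset.sum_eq_zero]
      · simp
      · intro i _
        rw [if_neg]
        rintro ⟨h1, h2, h3⟩
        exact hah (h1 ▸ (anc_parent (hpos i h3)).trans h2)
  rw [Finset.sum_congr rfl hpoint, Finset.sum_add_distrib, Finset.sum_add_distrib]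
  congr 1
  · congr 1
    rw [Finset.sum_ite_eq' (Finset.range (c + 1)) h, if_pos (Finset.mem_range.2 (by omega))]
  · rw [Finset.sum_comm]
    refine Finset.sum_congr rfl fun i hi => ?_
    by_cases hi' : Anc p i h ∧ C i
    · have := hp i (hpos i hi'.2)
      rw [Finset.mem_range] at hi
      simp only [hi', and_self, and_true, if_true]
      rw [Finset.sum_ite_eq (Finset.range (c + 1)) (p i), if_pos (Finset.mem_range.2 (by omega))]
    · simp only [hi', and_false, if_false, Finset.sum_const_zero]

/-! ### Ignition, and termination of the burning algorithm. -/

namespace BurnInv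

variable {n : ℕ} {x α : Fin n → ℕ} {s : BurnState n} {h : ℕ} {p : ℕ → ℕ}

lemma ignite_perm_of_le (s : BurnState n) (j : Fin n) {a : ℕ} (ha : a ≤ s.counter) :
    (ignite x s j).perm a = s.perm a :=
  Function.update_of_ne (by omega) _ _

lemma ignite_perm_self (s : BurnState n) (j : Fin n) :
    (ignite x s j).perm (s.counter + 1) = j.succ :=
  Function.update_self _ _ _

lemma ignite_mem_burning (s : BurnState n) (j : Fin n) (v : Fin (n + 1)) :
    v ∈ (ignite x s j).burning ↔ v = j.succ ∨ v ∈ s.burning :=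
  Finset.mem_insert

lemma ignite_edges_count (s : BurnState n) {j : Fin n} {u v : Fin (n + 1)} (hu : u ≠ j.succ)
    (hv : v ≠ j.succ) : (ignite x s j).edges.count s(u, v) = s.edges.count s(u, v) := by
  simp only [ignite, Multiset.count_add]
  rw [count_star_of_ne _ _ hu hv, add_zero]

/-- The label given to the edge along which `j` starts to burn. -/
lemma ignite_label_self (H : BurnInv x α s h p) {j : Fin n} (hj : j.succ ∉ s.burning)
    (hav : s(s.head, j.succ) ∈ s.edges - s.burnt) :
    s.burntCount h j + (1 + (ignite x s j).label s(s.perm h, j.succ)) = next x h := by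
  have hcount : ((ignite x s j).edges).count s(s.head, j.succ) = next x h := by
    simp only [ignite, Multiset.count_add]
    rw [H.head, H.edges h H.h_le j hj, Multiset.count_sum', Finset.sum_eq_zero, add_zero]
    intro k hk
    rw [mem_notBurning, Finset.mem_insert, not_or] at hk
    rw [Multiset.count_replicate, if_neg]
    rw [Sym2.eq_swap, Sym2.congr_left]
    intro h'
    exact hk.2 (h' ▸ H.perm_mem H.h_le)
  have hlabel : (ignite x s j).label s(s.head, j.succ) =
      ((ignite x s j).edges - (s.burnt + {s(s.head, j.succ)})).count s(s.head, j.succ) :=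
    Function.update_self _ _ _
  rw [H.available_iff hj] at hav
  rw [← H.head, hlabel, Multiset.count_sub, hcount, Multiset.count_add,
    Multiset.count_singleton_self, H.head]
  simp only [BurnState.burntCount] at hav ⊢
  omega

lemma ignite_label_of_mem {j : Fin n} (hj : j.succ ∉ s.burning)
    {u v : Fin (n + 1)} (hu : u ∈ s.burning) (hv : v ∈ s.burning) :
    (ignite x s j).label s(u, v) = s.label s(u, v) := by
  refine Function.update_of_ne ?_ _ _
  rw [Ne, Sym2.eq_iff]
  rintro (⟨_, rfl⟩ | ⟨rfl, _⟩)
  · exact hj hv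
  · exact hj hu

open Classical in
/-- An ignition preserves the invariant, if the parent function records it. -/
lemma ignite (H : BurnInv x α s h p) {j : Fin n} (hj : j ∈ s.todo)
    (hmax : ∀ k ∈ s.todo, k ≠ j → k < j) (hav : s(s.head, j.succ) ∈ s.edges - s.burnt)
    (hchips : s.chips j = 0) (hpc : p (s.counter + 1) = h) :
    BurnInv x α (ignite x s j) (s.counter + 1) p := by
  have hjB := H.todo j hj
  have hlab := H.ignite_label_self hjB hav
  have hlabold := fun u v => ignite_label_of_mem (x := x) hjB (u := u) (v := v)
  set s' := VectorParking.ignite x s j with hs'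
  have hc' : s'.counter = s.counter + 1 := rfl
  have hav' := (H.available_iff hjB).1 hav
  have hperm : ∀ a ≤ s.counter, s'.perm a = s.perm a := fun a ha => ignite_perm_of_le s j ha
  have hperm' : s'.perm (s.counter + 1) = j.succ := ignite_perm_self s j
  have hB : ∀ v, v ∈ s'.burning ↔ v = j.succ ∨ v ∈ s.burning := ignite_mem_burning s j
  have hB' : ∀ v, v ∉ s'.burning → v ≠ j.succ ∧ v ∉ s.burning := fun v hv => by
    rwa [hB, not_or] at hv
  have hcount : ∀ a ≤ s.counter, ∀ k, s'.burntCount a k = s.burntCount a k := by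
    intro a ha k
    simp only [BurnState.burntCount, hperm a ha]
    rfl
  have hcount' : ∀ k : Fin n, k.succ ∉ s.burning → s'.burntCount (s.counter + 1) k = 0 := by
    intro k hk
    simp only [BurnState.burntCount, hperm']
    exact H.burnt_zero _ _ hjB hk
  have hanc : ∀ i, Anc p i (s.counter + 1) ↔ i = s.counter + 1 ∨ Anc p i h := by
    intro i
    rw [anc_iff, hpc]
    simp
  -- A burning child of the head below `j` would force all edges from the head to `j` to be burnt.
  -- This rules out the second alternative of `todo_fresh` and gives the order of siblings.
  have hnolow : ∀ i, 0 < i → i ≤ s.counter → p i = h → j.succ < s.perm i := by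
    intro i i0 hi hpi
    by_contra hlt
    have hlt := lt_of_le_of_ne (not_lt.1 hlt) (H.perm_ne hi hjB)
    have := H.sibling_full i i0 hi j hjB hlt
    rw [hpi] at this
    omega
  refine
    { counter_le := H.counter_lt hjB
      rooted := ⟨?_, ?_, H.rooted.lt, ?_⟩
      mem_burning := ?_
      h_le := le_rfl
      head := hperm'.symm
      todo := fun k hk => mem_notBurning.1 hk
      edges := ?_
      edges_zero := ?_
      burnt_zero := fun v w hv hw => H.burnt_zero v w (hB' v hv).2 (hB' w hw).2
      burnt_le := ?_
      chips := ?_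
      dfs := ?_
      preorder := ?_
      sibling_full := ?_
      anc_zero := ?_
      done_full := ?_
      todo_full := fun k hk hk' => absurd (mem_notBurning.2 hk) hk'
      todo_fresh := fun k hk _ _ _ => Or.inl (hcount' k (hB' _ hk).2)
      order := ?_
      label_lt := ?_
      spec := ?_ }
  · rw [hperm 0 (Nat.zero_le _), H.rooted.zero]
  · intro a ha b hb hab
    rw [hc'] at ha hb
    rcases Nat.le_succ_iff.1 ha with ha | rfl <;> rcases Nat.le_succ_iff.1 hb with hb | rfl
    · rw [hperm a ha, hperm b hb] at hab
      exact H.rooted.inj a ha b hb hab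
    · rw [hperm a ha, hperm'] at hab
      exact absurd hab (H.perm_ne ha hjB)
    · rw [hperm b hb, hperm'] at hab
      exact absurd hab.symm (H.perm_ne hb hjB)
    · rfl
  · intro u v
    have htree : s'.tree.Adj u v ↔ s.tree.Adj u v ∨
        (u = j.succ ∧ v = s.perm h ∨ u = s.perm h ∧ v = j.succ) := by
      have hne := H.perm_ne H.h_le hjB
      change (s.tree ⊔ SimpleGraph.edge s.head j.succ).Adj u v ↔ _
      rw [SimpleGraph.sup_adj, SimpleGraph.edge_adj, H.head]
      refine or_congr Iff.rfl ⟨fun h' => ?_, fun h' => ?_⟩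
      · rcases h'.1 with h' | h'
        · exact Or.inr h'
        · exact Or.inl h'
      · rcases h' with ⟨rfl, rfl⟩ | ⟨rfl, rfl⟩
        · exact ⟨Or.inr ⟨rfl, rfl⟩, hne.symm⟩
        · exact ⟨Or.inl ⟨rfl, rfl⟩, hne⟩
    rw [htree, H.rooted.adj]
    constructor
    · rintro (⟨k, k0, hk, h'⟩ | h')
      · refine ⟨k, k0, hk.trans (Nat.le_succ _), ?_⟩
        rw [hperm k hk, hperm _ (H.parent_le k0 hk)]
        exact h'
      · refine ⟨s.counter + 1, Nat.succ_pos _, le_rfl, ?_⟩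
        rw [hperm', hpc, hperm h H.h_le]
        exact h'
    · rintro ⟨k, k0, hk, h'⟩
      rw [hc'] at hk
      rcases Nat.le_succ_iff.1 hk with hk | rfl
      · rw [hperm k hk, hperm _ (H.parent_le k0 hk)] at h'
        exact Or.inl ⟨k, k0, hk, h'⟩
      · rw [Nat.succ_eq_add_one, hperm', hpc, hperm h H.h_le] at h'
        exact Or.inr h'
  · intro v
    rw [hB, H.mem_burning]
    constructor
    · rintro (rfl | ⟨k, hk, rfl⟩)
      · exact ⟨s.counter + 1, le_rfl, hperm'⟩
      · exact ⟨k, hk.trans (Nat.le_succ _), hperm k hk⟩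
    · rintro ⟨k, hk, rfl⟩
      rw [hc'] at hk
      rcases Nat.le_succ_iff.1 hk with hk | rfl
      · exact Or.inr ⟨k, hk, (hperm k hk).symm⟩
      · exact Or.inl hperm'
  · intro a ha k hk
    obtain ⟨hkj, hkB⟩ := hB' _ hk
    rw [hc'] at ha
    rcases Nat.le_succ_iff.1 ha with ha | rfl
    · rw [hperm a ha, hs', ignite_edges_count s (H.perm_ne ha hjB) hkj, H.edges a ha k hkB]
    · rw [Nat.succ_eq_add_one, hperm']
      simp only [hs', VectorParking.ignite, Multiset.count_add]
      rw [H.edges_zero _ _ hjB hkB, zero_add, count_star]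
      exact mem_notBurning.2 hk
  · intro v w hv hw
    obtain ⟨hvj, hvB⟩ := hB' _ hv
    obtain ⟨hwj, hwB⟩ := hB' _ hw
    rw [hs', ignite_edges_count s hvj hwj, H.edges_zero v w hvB hwB]
  · intro a ha k hk
    rw [hc'] at ha
    rcases Nat.le_succ_iff.1 ha with ha | rfl
    · rw [hcount a ha]
      exact H.burnt_le a ha k (hB' _ hk).2
    · rw [Nat.succ_eq_add_one, hcount' k (hB' _ hk).2]
      exact Nat.zero_le _
  · intro k hk
    rw [hc', Finset.sum_range_succ, hcount' k (hB' _ hk).2, add_zero, ← H.chips k (hB' _ hk).2]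
    congr 1
    refine Finset.sum_congr rfl fun a ha => hcount a ?_ k
    rw [Finset.mem_range] at ha
    omega
  · intro i i0 hi k hik hk
    rw [hc'] at hk
    rcases Nat.le_succ_iff.1 hk with hk | rfl
    · rcases (hanc i).1 hi with rfl | hi
      · omega
      · exact H.dfs i i0 hi k hik hk
    · exact hi
  · intro i k l i0 hik hkl hl hil
    rw [hc'] at hl
    rcases Nat.le_succ_iff.1 hl with hl | rfl
    · exact H.preorder i k l i0 hik hkl hl hil
    · rcases (hanc i).1 hil with rfl | hi
      · omega
      · exact H.dfs i i0 hi k hik.le (by omega)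
  · intro i i0 hi k hk hik
    obtain ⟨hkj, hkB⟩ := hB' _ hk
    rw [hc'] at hi
    rcases Nat.le_succ_iff.1 hi with hi | rfl
    · rw [hperm i hi] at hik
      rw [hcount _ (H.parent_le i0 hi)]
      exact H.sibling_full i i0 hi k hkB hik
    · rw [Nat.succ_eq_add_one, hperm', Fin.succ_lt_succ_iff] at hik
      rw [Nat.succ_eq_add_one, hpc, hcount h H.h_le]
      refine H.todo_full k hkB fun hkt => ?_
      exact absurd (hmax k hkt hik.ne') hik.asymm
  · intro i i0 hi k hk hik
    obtain ⟨hkj, hkB⟩ := hB' _ hk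
    rcases (hanc i).1 hi with rfl | hi
    · rw [hperm', Fin.succ_lt_succ_iff] at hik
      rw [hpc, hcount h H.h_le]
      refine (H.todo_fresh k hkB j hj hik).resolve_right ?_
      rintro ⟨i, i0, hi, hpi, hik'⟩
      exact absurd (hik'.trans (Fin.succ_lt_succ_iff.2 hik)) (hnolow i i0 hi hpi).asymm
    · have hic := (hi.le H.rooted.lt).trans H.h_le
      rw [hperm i hic] at hik
      rw [hcount _ (H.parent_le i0 hic)]
      exact H.anc_zero i i0 hi k hkB hik
  · intro a ha hna k hk
    rw [hc'] at ha
    rcases Nat.le_succ_iff.1 ha with ha | rfl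
    · rw [hcount a ha]
      exact H.done_full a ha (fun h' => hna ((hanc a).2 (Or.inr h'))) k (hB' _ hk).2
    · exact absurd Anc.refl hna
  · intro i k i0 hik hk hpik
    rw [hc'] at hk
    rw [hperm i (by omega)]
    rcases Nat.le_succ_iff.1 hk with hk | rfl
    · rw [hperm k hk]
      exact H.order i k i0 hik hk hpik
    · rw [Nat.succ_eq_add_one, hperm']
      exact hnolow i i0 (by omega) (hpik.trans hpc)
  · intro k k0 hk
    rw [hc'] at hk
    rcases Nat.le_succ_iff.1 hk with hk | rfl
    · have hpk := H.parent_le k0 hk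
      rw [hperm k hk, hperm _ hpk, hlabold _ _ (H.perm_mem hpk) (H.perm_mem hk)]
      exact H.label_lt k k0 hk
    · rw [Nat.succ_eq_add_one, hperm', hpc, hperm h H.h_le]
      omega
  · intro k k0 hk l hl
    rw [hc'] at hk
    rcases Nat.le_succ_iff.1 hk with hk | rfl
    · have hpk := H.parent_le k0 hk
      rw [hperm k hk] at hl
      rw [hperm k hk, hperm _ hpk, hlabold _ _ (H.perm_mem hpk) (H.perm_mem hk),
        ← H.spec k k0 hk l hl]
      congr 1
      refine Finset.sum_congr rfl fun i hi => ?_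
      rw [Finset.mem_range] at hi
      rw [hperm i (by omega)]
    · rw [Nat.succ_eq_add_one, hperm'] at hl
      obtain rfl := Fin.succ_injective _ hl
      -- The condition `C i` separates the ancestors whose parents were suspended above `j` from
      -- those whose parents had already passed `j`.
      have hsum := sum_eq_of_burnt (c := s.counter) (h := h) (p := p) (w := next x)
        (b := fun a => s.burntCount a j) (C := fun i => j.succ < s.perm i) H.rooted.lt H.h_le
        (by rw [H.rooted.zero]; exact not_lt.2 (Fin.zero_le _)) hlab
        (fun a ha hna => H.done_full a ha hna j hjB)
        (fun i i0 hi hlt => H.anc_zero i i0 hi j hjB hlt)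
        (fun i i0 hi hlt => by
          have hic := (hi.le H.rooted.lt).trans H.h_le
          exact H.sibling_full i i0 hic j hjB (lt_of_le_of_ne (not_lt.1 hlt) (H.perm_ne hic hjB)))
      have hchip := H.chips j hjB
      rw [hchips, zero_add] at hchip
      rw [Nat.succ_eq_add_one, hsum, hchip, Finset.sum_range_succ, hperm', hpc, hperm h H.h_le,
        if_neg (fun h' => lt_irrefl _ h'.2), add_zero, add_assoc (α j)]
      congr 1
      refine Finset.sum_congr rfl fun i hi => ?_
      rw [Finset.mem_range] at hi
      have hne : i ≠ s.counter + 1 := by omega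
      rw [hperm i (by omega)]
      exact if_congr (and_congr ((hanc i).trans (or_iff_right hne)) Iff.rfl) rfl rfl

/-- One step of the burning algorithm. -/
lemma exists_step (H : BurnInv x α s h p) :
    (burnStep x s = none ∧ s.todo = ∅ ∧ h = 0) ∨
    ∃ s' h' p', burnStep x s = some s' ∧ BurnInv x α s' h' p' ∧
      toLex (n - s'.counter, toLex ((s'.edges - s'.burnt).card, toLex (h', s'.todo.card))) <
        toLex (n - s.counter, toLex ((s.edges - s.burnt).card, toLex (h, s.todo.card))) := by
  rcases hm : maxOf (· < ·) s.todo with _ | j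
  · have htodo := maxOf_eq_none.1 hm
    by_cases h0 : h = 0
    · refine Or.inl ⟨?_, htodo, h0⟩
      simp [burnStep, hm, H.head, h0, H.rooted.zero]
    · right
      have hhead : s.head ≠ 0 := by
        rw [H.head, ← H.rooted.zero]
        exact fun h' => h0 (H.rooted.inj h H.h_le 0 (Nat.zero_le _) h')
      refine ⟨_, _, p, ?_, H.backtrack htodo (Nat.pos_of_ne_zero h0), ?_⟩
      · simp [burnStep, hm, hhead]
      · exact Prod.Lex.toLex_lt_toLex.2 (Or.inr ⟨rfl, Prod.Lex.toLex_lt_toLex.2 (Or.inr ⟨rfl,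
          Prod.Lex.toLex_lt_toLex.2 (Or.inl (H.rooted.lt h (Nat.pos_of_ne_zero h0)))⟩)⟩)
  · right
    obtain ⟨hj, hmax⟩ := maxOf_eq_some.1 hm
    by_cases hav : s(s.head, j.succ) ∈ s.edges - s.burnt
    · by_cases hchips : 1 ≤ s.chips j
      · refine ⟨_, h, p, ?_, H.burn hj hmax hav hchips, ?_⟩
        · simp only [burnStep, hm, if_pos hav, if_pos hchips]
        · exact Prod.Lex.toLex_lt_toLex.2 (Or.inr ⟨rfl, Prod.Lex.toLex_lt_toLex.2
            (Or.inl (card_sub_add_singleton_lt hav))⟩)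
      · have hchips' : s.chips j = 0 := by omega
        have hq : ∀ k, 0 < k → Function.update p (s.counter + 1) h k < k := by
          intro k k0
          by_cases hk : k = s.counter + 1
          · rw [hk, Function.update_self]
            exact Nat.lt_succ_of_le H.h_le
          · rw [Function.update_of_ne hk]
            exact H.rooted.lt k k0
        -- The number `counter + 1` is not yet in use, so the parent function may be changed there
        -- to record that the new vertex hangs from `h`.
        have H' := H.congr_parent hq fun k hk => (Function.update_of_ne (by omega) _ _).symm
        refine ⟨_, _, _, ?_, H'.ignite hj hmax hav hchips' (Function.update_self _ _ _), ?_⟩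
        · simp only [burnStep, hm, if_pos hav, if_neg hchips]
        · refine Prod.Lex.toLex_lt_toLex.2 (Or.inl ?_)
          have := H.counter_lt (H.todo j hj)
          change n - (s.counter + 1) < n - s.counter
          omega
    · refine ⟨_, h, p, ?_, H.erase hj hav, ?_⟩
      · simp only [burnStep, hm, if_neg hav]
      · exact Prod.Lex.toLex_lt_toLex.2 (Or.inr ⟨rfl, Prod.Lex.toLex_lt_toLex.2 (Or.inr ⟨rfl,
          Prod.Lex.toLex_lt_toLex.2 (Or.inr ⟨rfl, Finset.card_erase_lt_of_mem hj⟩)⟩)⟩)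

end BurnInv

/-- The burning algorithm terminates on every input. -/
lemma burn_terminates {n : ℕ} (x α : Fin n → ℕ) :
    ∃ s p, StateTransition.Reaches (burnStep x) (burnInit x α) s ∧ burnStep x s = none ∧
      BurnInv x α s 0 p ∧ s.todo = ∅ := by
  obtain ⟨s, ⟨h, p⟩, h1, h2, H⟩ := exists_halting (burnStep x)
    (fun s (g : ℕ × (ℕ → ℕ)) => BurnInv x α s g.1 g.2)
    (fun s g => toLex (n - s.counter, toLex ((s.edges - s.burnt).card, toLex (g.1, s.todo.card))))
    (fun s g H => by
      rcases H.exists_step with h | ⟨s', h', p', h⟩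
      · exact Or.inl h.1
      · exact Or.inr ⟨s', (h', p'), h⟩)
    (burnInit x α) (0, fun _ => 0) (BurnInv.init x α fun k hk => hk)
  rcases H.exists_step with h | ⟨s', h', p', h, _⟩
  · obtain ⟨_, htodo, rfl⟩ := h
    exact ⟨s, p, h1, h2, H, htodo⟩
  · rw [h2] at h
    exact absurd h (by simp)

/-! ### Sorting permutations -/

lemma exists_sorting {V : Type*} [Fintype V] (lt : V → V → Prop) [IsStrictTotalOrder V lt] :
    ∃ e : Fin (Fintype.card V) ≃ V, ∀ i j, i < j → lt (e i) (e j) := by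
  classical
  let _ := linearOrderOfSTO lt
  exact ⟨(monoEquivOfFin V rfl).toEquiv, fun i j hij => (monoEquivOfFin V rfl).strictMono hij⟩

lemma sortPerm_lt_iff {n : ℕ} (lt : Fin n → Fin n → Prop) [IsStrictTotalOrder (Fin n) lt]
    (i j : Fin n) : lt (sortPerm lt i) (sortPerm lt j) ↔ i < j := by
  have hex : ∃ σ : Equiv.Perm (Fin n), ∀ i j : Fin n, i < j → lt (σ i) (σ j) := by
    obtain ⟨e, he⟩ := exists_sorting lt
    refine ⟨(finCongr (Fintype.card_fin n).symm).trans e, fun i j hij => he _ _ hij⟩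
  have hmono : ∀ i j : Fin n, i < j → lt (sortPerm lt i) (sortPerm lt j) := by
    rw [sortPerm, dif_pos hex]
    exact hex.choose_spec
  refine ⟨fun h => ?_, hmono i j⟩
  rcases lt_trichotomy i j with h' | rfl | h'
  · exact h'
  · exact absurd h (irrefl _)
  · exact absurd h (asymm (hmono j i h'))

/-- Two sorting permutations differ by an order automorphism of `Fin n`, which is trivial. -/
lemma sortPerm_eq {n : ℕ} {lt : Fin n → Fin n → Prop} [IsStrictTotalOrder (Fin n) lt]
    {σ : Equiv.Perm (Fin n)} (hσ : ∀ i j, lt (σ i) (σ j) ↔ i < j) : sortPerm lt = σ := by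
  have hmono : StrictMono ((sortPerm lt).trans σ.symm) := by
    intro i j hij
    rw [← hσ]
    simpa using (sortPerm_lt_iff lt i j).2 hij
  have h1 : (⟨(sortPerm lt).trans σ.symm, hmono.le_iff_le⟩ : Fin n ≃o Fin n) = OrderIso.refl _ :=
    Subsingleton.elim _ _
  ext i
  have h2 := DFunLike.congr_fun h1 i
  have h3 : σ.symm (sortPerm lt i) = i := h2
  rw [Equiv.symm_apply_eq] at h3
  rw [h3]

/-! ### Sums -/

lemma sum_range_next {n : ℕ} (x : Fin n → ℕ) (k : Fin n) :
    ∑ a ∈ Finset.range (k.val + 1), next x a = ∑ a ∈ Finset.Iic k, x a := by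
  rw [Nat.range_succ_eq_Iic, ← Fin.map_valEmbedding_Iic, Finset.sum_map]
  refine Finset.sum_congr rfl fun a _ => ?_
  simp [next]

lemma sum_sum_Iic {n : ℕ} (x : Fin n → ℕ) :
    ∑ k : Fin n, ∑ a ∈ Finset.Iic k, (x a : ℤ) = ∑ i : Fin n, ((n : ℤ) - (i.val : ℤ)) * (x i : ℤ) := by
  rw [Finset.sum_comm' (t' := Finset.univ) (s' := fun a => Finset.Ici a) (by simp)]
  refine Finset.sum_congr rfl fun a _ => ?_
  rw [Finset.sum_const, Fin.card_Ici, nsmul_eq_mul, Nat.cast_sub a.isLt.le]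

/-! ### Parking functions -/

/-- Pigeonhole: if the sorted entry at position `j` violated the bound, the `n - j` entries from
there on would all have `τ`-value above `j`, where only `n - 1 - j` values exist. -/
lemma isParking_of_lt {n : ℕ} {x α : Fin n → ℕ} (τ : Equiv.Perm (Fin n))
    (h : ∀ j, α j < ∑ a ∈ Finset.Iic (τ j), x a) : IsParking x α := by
  intro j
  by_contra hj
  have hj : ∑ a ∈ Finset.Iic j, x a ≤ α (Tuple.sort α j) := by
    zify
    omega
  have hmaps : ∀ k ∈ Finset.Ici j, τ (Tuple.sort α k) ∈ Finset.Ioi j := by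
    intro k hk
    rw [Finset.mem_Ici] at hk
    rw [Finset.mem_Ioi]
    by_contra hle
    have h1 := h (Tuple.sort α k)
    have h2 : ∑ a ∈ Finset.Iic (τ (Tuple.sort α k)), x a ≤ ∑ a ∈ Finset.Iic j, x a :=
      Finset.sum_le_sum_of_subset (Finset.Iic_subset_Iic.2 (not_lt.1 hle))
    have h3 : α (Tuple.sort α j) ≤ α (Tuple.sort α k) := Tuple.monotone_sort α hk
    omega
  have hcard := Finset.card_le_card_of_injOn _ hmaps
    ((τ.injective.comp (Tuple.sort α).injective).injOn)
  rw [Fin.card_Ici, Fin.card_Ioi] at hcard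
  omega

namespace BurnInv

variable {n : ℕ} {x α : Fin n → ℕ} {s : BurnState n} {h : ℕ} {p : ℕ → ℕ}

/-- On a parking function, the algorithm burns all vertices. -/
lemma counter_eq_of_isParking (H : BurnInv x α s 0 p) (htodo : s.todo = ∅) (hα : IsParking x α) :
    s.counter = n := by
  by_contra hne
  have hc := lt_of_le_of_ne H.counter_le hne
  -- At the end all edges from burning to non-burning vertices are burnt, so an unlit vertex has at
  -- least x_1 + ⋯ + x_{c+1} chips, with c the counter. The c + 1 smallest entries are below this
  -- bound, yet only c non-root vertices burn.
  have hburn : ∀ k : Fin n, k ≤ ⟨s.counter, hc⟩ →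
      ∃ a ∈ Finset.Icc 1 s.counter, s.perm a = (Tuple.sort α k).succ := by
    intro k hk
    have hmem : (Tuple.sort α k).succ ∈ s.burning := by
      by_contra hnot
      have h1 := H.chips _ hnot
      have h2 : ∑ a ∈ Finset.range (s.counter + 1), s.burntCount a (Tuple.sort α k) =
          ∑ a ∈ Finset.range (s.counter + 1), next x a := by
        refine Finset.sum_congr rfl fun a ha => ?_
        rw [Finset.mem_range] at ha
        rcases Nat.eq_zero_or_pos a with rfl | a0
        · exact H.todo_full _ hnot (by simp [htodo])
        · exact H.done_full a (by omega) (fun h' => by have := h'.eq_zero; omega) _ hnot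
      have h3 := sum_range_next x ⟨s.counter, hc⟩
      have h4 := hα ⟨s.counter, hc⟩
      have h5 : α (Tuple.sort α k) ≤ α (Tuple.sort α ⟨s.counter, hc⟩) :=
        Tuple.monotone_sort α hk
      simp only at h3
      zify at h1 h2 h3 h5
      omega
    obtain ⟨a, ha, hperm⟩ := (H.mem_burning _).1 hmem
    refine ⟨a, Finset.mem_Icc.2 ⟨?_, ha⟩, hperm⟩
    rcases Nat.eq_zero_or_pos a with rfl | a0
    · rw [H.rooted.zero] at hperm
      exact absurd hperm.symm (Fin.succ_ne_zero _)
    · exact a0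
  choose! f hf hfperm using hburn
  have hcard := Finset.card_le_card_of_injOn (s := Finset.Iic (⟨s.counter, hc⟩ : Fin n)) f
    (fun k hk => hf k (Finset.mem_Iic.1 hk)) (by
      intro k hk l hl hkl
      have hk := hfperm k (Finset.mem_Iic.1 hk)
      have hl := hfperm l (Finset.mem_Iic.1 hl)
      rw [hkl, hl] at hk
      exact (Tuple.sort α).injective (Fin.succ_injective _ hk.symm))
  rw [Fin.card_Iic, Nat.card_Icc] at hcard
  simp only at hcard
  omega

end BurnInv

/-! ### The output -/

open Classical in
/-- The label of an edge of the tree, extended by `0` to all pairs of vertices. -/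
noncomputable def Triple.labelAt {n : ℕ} (t : Triple n) (e : Sym2 (Fin (n + 1))) : ℕ :=
  if h : e ∈ t.tree.edgeSet then t.label ⟨e, h⟩ else 0

lemma Triple.labelAt_of_mem {n : ℕ} (t : Triple n) {e : Sym2 (Fin (n + 1))}
    (h : e ∈ t.tree.edgeSet) : t.labelAt e = t.label ⟨e, h⟩ := dif_pos h

lemma Triple.ext_of {n : ℕ} {t t' : Triple n} (htree : t.tree = t'.tree)
    (hlabel : ∀ e ∈ t.tree.edgeSet, t.labelAt e = t'.labelAt e)
    (hlt : ∀ i j, t.lt i j ↔ t'.lt i j) : t = t' := by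
  obtain ⟨T, l, r⟩ := t
  obtain ⟨T', l', r'⟩ := t'
  obtain rfl : T = T' := htree
  have h1 : l = l' := by
    funext ⟨e, he⟩
    have := hlabel e he
    rwa [Triple.labelAt_of_mem _ he, Triple.labelAt_of_mem _ he] at this
  have h2 : r = r' := by
    funext i j
    exact propext (hlt i j)
  rw [h1, h2]

open Classical in
/-- The contribution of the pairs with second component `k` to `κ`. -/
noncomputable def kappaAt {n : ℕ} (x : Fin n → ℕ) (t : Triple n) (k : Fin n) : ℕ :=
  ∑ i : Fin n, if TreeLE t.tree i.succ k.succ ∧ t.lt k i then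
    (Gx x).weight s(par t.tree i.succ, k.succ) else 0

/-- The value of the parking function of `t` at `j`, in terms of `t`. -/
def Encodes {n : ℕ} (x α : Fin n → ℕ) (t : Triple n) : Prop :=
  ∀ j : Fin n, α j + 1 + t.labelAt s(par t.tree (sortPerm t.lt j).succ, (sortPerm t.lt j).succ) +
    kappaAt x t (sortPerm t.lt j) = ∑ a ∈ Finset.Iic (sortPerm t.lt j), x a

/-- Only `α j` in the identity is not determined by `t`; this is the injectivity of the algorithm.
-/
lemma Encodes.unique {n : ℕ} {x α β : Fin n → ℕ} {t : Triple n} (hα : Encodes x α t)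
    (hβ : Encodes x β t) : α = β := by
  funext j
  have h1 := hα j
  have h2 := hβ j
  omega

lemma Encodes.isParking {n : ℕ} {x α : Fin n → ℕ} {t : Triple n} (hα : Encodes x α t) :
    IsParking x α := by
  refine isParking_of_lt (sortPerm t.lt) fun j => ?_
  have := hα j
  omega

lemma IsRooted.par_succ {n : ℕ} {T : SimpleGraph (Fin (n + 1))} {p : ℕ → ℕ}
    (h : IsRooted T n (vert n) p) (j : Fin n) : par T j.succ = vert n (p (j.val + 1)) := by
  rw [← vert_succ, h.par_eq (Nat.succ_pos _) j.isLt]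

/-- Translates a part of κ into the sum in `BurnInv.spec`. Ancestors of a vertex have smaller
numbers, so the range may be cut off, and `p i` is the smaller endpoint of the edge being weighed.
-/
lemma kappaAt_eq {n : ℕ} (x : Fin n → ℕ) {t : Triple n} {p : ℕ → ℕ} {k : Fin n} {C : ℕ → Prop}
    [∀ i, Decidable (Anc p i (k.val + 1) ∧ C i)] (h : IsRooted t.tree n (vert n) p) (hC0 : ¬ C 0)
    (hC : ∀ i : Fin n, t.lt k i ↔ C (i.val + 1)) :
    kappaAt x t k = ∑ i ∈ Finset.range (k.val + 2),
      if Anc p i (k.val + 1) ∧ C i then next x (p i) else 0 := by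
  have hsub : Finset.range (k.val + 2) ⊆ Finset.range (n + 1) :=
    Finset.range_subset_range.2 (by omega)
  rw [Finset.sum_subset hsub, Finset.sum_range_succ', Finset.sum_range, if_neg (fun h' => hC0 h'.2),
    add_zero, kappaAt]
  · refine Finset.sum_congr rfl fun i _ => ?_
    have h1 : TreeLE t.tree i.succ k.succ ↔ Anc p (i.val + 1) (k.val + 1) := by
      rw [← vert_succ, ← vert_succ, h.treeLE_iff i.isLt k.isLt]
    by_cases hc : TreeLE t.tree i.succ k.succ ∧ t.lt k i
    · rw [if_pos hc, if_pos ⟨h1.1 hc.1, (hC i).1 hc.2⟩, h.par_succ, ← vert_succ k]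
      have := (h1.1 hc.1).le h.lt
      have := h.lt (i.val + 1) (Nat.succ_pos _)
      exact Gx_weight x (by omega) k.isLt
    · rw [if_neg hc, if_neg]
      rw [h1, hC i] at hc
      exact hc
  · intro i _ hi
    rw [if_neg]
    rintro ⟨h', _⟩
    have := h'.le h.lt
    exact hi (Finset.mem_range.2 (by omega))

lemma kappa_eq_sum {n : ℕ} (x : Fin n → ℕ) (t : Triple n) :
    kappa (Gx x) t.tree t.lt = ∑ k : Fin n, kappaAt x t k := by
  rw [kappa, Finset.sum_comm]
  rfl

lemma labelSum_eq {n : ℕ} {t : Triple n} {p : ℕ → ℕ} (h : IsRooted t.tree n (vert n) p) :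
    t.labelSum = ∑ k : Fin n, t.labelAt s(par t.tree k.succ, k.succ) := by
  classical
  rw [Triple.labelSum, ← h.parentEdge_bijective.sum_comp]
  refine Finset.sum_congr rfl fun k _ => ?_
  rw [← t.labelAt_of_mem (h.parentEdge_mem k), h.par_succ, parentEdge]

/-- Sum the identity over all `j` and reindex by `sortPerm`. The prefix sums add up to the weighted
sum of the `x i`, and the ones to `n`. -/
lemma Encodes.rsum_eq {n : ℕ} {x α : Fin n → ℕ} {t : Triple n} (hα : Encodes x α t)
    {p : ℕ → ℕ} (h : IsRooted t.tree n (vert n) p) :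
    rsum x α = (kappa (Gx x) t.tree t.lt : ℤ) + (t.labelSum : ℤ) := by
  have h1 : ∑ j : Fin n, (((α j : ℤ) + 1 +
      t.labelAt s(par t.tree (sortPerm t.lt j).succ, (sortPerm t.lt j).succ)) +
      kappaAt x t (sortPerm t.lt j)) = ∑ j : Fin n, ∑ a ∈ Finset.Iic (sortPerm t.lt j), (x a : ℤ) :=
    Finset.sum_congr rfl fun j _ => by exact_mod_cast hα j
  simp only [Finset.sum_add_distrib] at h1
  rw [Equiv.sum_comp (sortPerm t.lt) fun k => ∑ a ∈ Finset.Iic k, (x a : ℤ),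
    Equiv.sum_comp (sortPerm t.lt) fun k => (kappaAt x t k : ℤ),
    Equiv.sum_comp (sortPerm t.lt) fun k => (t.labelAt s(par t.tree k.succ, k.succ) : ℤ),
    sum_sum_Iic] at h1
  rw [kappa_eq_sum, labelSum_eq h, rsum, ← h1]
  push_cast
  simp
  ring

/-- The number, in the order of burning, determines the original name of a vertex. -/
lemma BurnInv.exists_perm {n : ℕ} {x α : Fin n → ℕ} {s : BurnState n} {h : ℕ} {p : ℕ → ℕ}
    (H : BurnInv x α s h p) (hc : s.counter = n) :
    ∃ g : Equiv.Perm (Fin n), ∀ i : Fin n, s.perm (i.val + 1) = (g i).succ := by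
  have hne : ∀ i : Fin n, s.perm (i.val + 1) ≠ 0 := by
    intro i h'
    rw [← H.rooted.zero] at h'
    have := H.rooted.inj _ (by omega) 0 (Nat.zero_le _) h'
    omega
  refine ⟨Equiv.ofBijective (fun i => (s.perm (i.val + 1)).pred (hne i))
    (Finite.injective_iff_bijective.1 ?_), fun i => ?_⟩
  · intro i j hij
    rw [Fin.pred_inj] at hij
    have := H.rooted.inj _ (by omega) _ (by omega) hij
    exact Fin.ext (by omega)
  · rw [Equiv.ofBijective_apply, Fin.succ_pred]

/-! ### The triple read off from a run that burns every vertex. -/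

namespace BurnInv

variable {n : ℕ} {x α : Fin n → ℕ} {s : BurnState n} {h : ℕ} {p : ℕ → ℕ}

/-- The relabelling by `σ⁻¹` replaces names by burning numbers, so the same `p` is the parent
function of the output. -/
lemma rooted_output (H : BurnInv x α s h p) (hc : s.counter = n) :
    IsRooted (burnOutput s).tree n (vert n) p := by
  have hsurj : ∀ a : ℕ, ∀ ha : a ≤ n, ∀ u : Fin (n + 1), s.perm u.val = s.perm a ↔ u = vert n a := by
    intro a ha u
    constructor
    · intro h'
      have := H.rooted.inj _ (by have := u.isLt; omega) _ (by omega) h'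
      rw [← this, vert_val]
    · rintro rfl
      rw [val_vert ha]
  refine ⟨vert_zero n, fun a ha b hb => vert_inj ha hb, H.rooted.lt, fun u v => ?_⟩
  have h1 : (burnOutput s).tree.Adj u v ↔ s.tree.Adj (s.perm u.val) (s.perm v.val) := by
    change (u.val ≤ s.counter ∧ v.val ≤ s.counter ∧ _) ↔ _
    have := u.isLt
    have := v.isLt
    exact ⟨fun h' => h'.2.2, fun h' => ⟨by omega, by omega, h'⟩⟩
  rw [h1, H.rooted.adj, hc]
  refine exists_congr fun k => and_congr_right fun k0 => and_congr_right fun hk => ?_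
  have hpk := (H.rooted.lt k k0).le.trans hk
  rw [hsurj k hk, hsurj k hk, hsurj _ hpk, hsurj _ hpk]

lemma output_lt_iff (hc : s.counter = n) {g : Equiv.Perm (Fin n)}
    (hg : ∀ i : Fin n, s.perm (i.val + 1) = (g i).succ) (i j : Fin n) :
    (burnOutput s).lt i j ↔ g i < g j := by
  change (i.succ.val ≤ s.counter ∧ j.succ.val ≤ s.counter ∧
    s.perm i.succ.val < s.perm j.succ.val) ↔ _
  rw [Fin.val_succ, Fin.val_succ, hg, hg, Fin.succ_lt_succ_iff]
  have := i.isLt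
  have := j.isLt
  exact ⟨fun h' => h'.2.2, fun h' => ⟨by omega, by omega, h'⟩⟩

lemma output_isStrictTotalOrder (hc : s.counter = n) {g : Equiv.Perm (Fin n)}
    (hg : ∀ i : Fin n, s.perm (i.val + 1) = (g i).succ) :
    IsStrictTotalOrder (Fin n) (burnOutput s).lt :=
  RelEmbedding.isStrictTotalOrder (s := (· < ·))
    ⟨g.toEmbedding, fun {i j} => (output_lt_iff hc hg i j).symm⟩

/-- The map `g` sends burning numbers to names, and ≺ compares names; sorting by ≺ therefore sends a
name to its burning number. -/
lemma sortPerm_output (hc : s.counter = n) {g : Equiv.Perm (Fin n)}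
    (hg : ∀ i : Fin n, s.perm (i.val + 1) = (g i).succ) :
    sortPerm (burnOutput s).lt = g.symm := by
  have := output_isStrictTotalOrder hc hg
  refine sortPerm_eq fun i j => ?_
  rw [output_lt_iff hc hg]
  simp

lemma labelAt_output (H : BurnInv x α s h p) (hc : s.counter = n) {k : ℕ} (k0 : 0 < k)
    (hk : k ≤ n) : (burnOutput s).labelAt s(vert n (p k), vert n k) =
      s.label s(s.perm (p k), s.perm k) := by
  have hpk := (H.rooted.lt k k0).le.trans hk
  have hmem : s(vert n (p k), vert n k) ∈ (burnOutput s).tree.edgeSet :=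
    ((H.rooted_output hc).adj_parent k0 hk).symm
  rw [Triple.labelAt_of_mem _ hmem]
  change s.label (Sym2.map (fun a : Fin (n + 1) => s.perm a.val) s(vert n (p k), vert n k)) = _
  rw [Sym2.map_mk]
  simp only [val_vert hpk, val_vert hk]

lemma output_mem_triples (H : BurnInv x α s h p) (hc : s.counter = n) :
    burnOutput s ∈ Triples x := by
  have hroot := H.rooted_output hc
  obtain ⟨g, hg⟩ := H.exists_perm hc
  refine ⟨hroot.isRootedPlaneTree (hc ▸ H.preorder), ⟨output_isStrictTotalOrder hc hg, ?_⟩, ?_⟩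
  · intro i j hij hpar
    rw [hroot.par_succ, hroot.par_succ] at hpar
    have hi := hroot.lt (i.val + 1) (Nat.succ_pos _)
    have hj := hroot.lt (j.val + 1) (Nat.succ_pos _)
    have hp := vert_inj (by omega) (by omega) hpar
    have := H.order (i.val + 1) (j.val + 1) (Nat.succ_pos _) (Nat.succ_lt_succ hij) (by omega) hp
    rw [hg, hg, Fin.succ_lt_succ_iff] at this
    exact (output_lt_iff hc hg j i).2 this
  · intro e
    obtain ⟨j, rfl⟩ := hroot.parentEdge_bijective.2 e
    have hlt := hroot.lt (j.val + 1) (Nat.succ_pos _)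
    dsimp only
    rw [← Triple.labelAt_of_mem, parentEdge, ← vert_succ,
      H.labelAt_output hc (Nat.succ_pos _) j.isLt, Gx_weight x hlt j.isLt]
    exact H.label_lt _ (Nat.succ_pos _) (by omega)

lemma encodes_output (H : BurnInv x α s h p) (hc : s.counter = n) :
    Encodes x α (burnOutput s) := by
  classical
  have hroot := H.rooted_output hc
  obtain ⟨g, hg⟩ := H.exists_perm hc
  intro j
  rw [sortPerm_output hc hg]
  obtain ⟨k, rfl⟩ := g.surjective j
  rw [Equiv.symm_apply_apply, ← sum_range_next, hroot.par_succ, ← vert_succ,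
    H.labelAt_output hc (Nat.succ_pos _) k.isLt,
    kappaAt_eq x (C := fun i => s.perm (k.val + 1) < s.perm i) hroot,
    ← H.spec (k.val + 1) (Nat.succ_pos _) (by omega) (g k) (hg k)]
  · rw [H.rooted.zero]
    exact not_lt.2 (Fin.zero_le _)
  · intro i
    rw [output_lt_iff hc hg, hg, hg, Fin.succ_lt_succ_iff]

end BurnInv

/-! ### The inverse algorithm -/

/-- The membership of `t` in `Triples x`, in terms of the parent function `p` of the tree. -/
structure IsTriple {n : ℕ} (x : Fin n → ℕ) (t : Triple n) (p : ℕ → ℕ) : Prop where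
  rooted : IsRooted t.tree n (vert n) p
  preorder : IsPreorder n p
  total : IsStrictTotalOrder (Fin n) t.lt
  sibling : ∀ i j : Fin n, i < j → p (i.val + 1) = p (j.val + 1) → t.lt j i
  label_lt : ∀ k, 0 < k → k ≤ n → t.labelAt s(vert n (p k), vert n k) < next x (p k)

lemma exists_isTriple {n : ℕ} {x : Fin n → ℕ} {t : Triple n} (ht : t ∈ Triples x) :
    ∃ p, IsTriple x t p := by
  obtain ⟨h1, h2, h3⟩ := ht
  obtain ⟨p, hroot, hpre⟩ := h1.exists_isRooted
  refine ⟨p, hroot, hpre, h2.1, fun i j hij hp => h2.2 i j hij ?_, fun k k0 hk => ?_⟩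
  · rw [hroot.par_succ, hroot.par_succ, hp]
  · have hmem : s(vert n (p k), vert n k) ∈ t.tree.edgeSet := (hroot.adj_parent k0 hk).symm
    rw [t.labelAt_of_mem hmem, ← Gx_weight x (hroot.lt k k0) hk]
    exact h3 _

/-- The invariant of the inverse algorithm: the vertices `0, …, c` burn. -/
structure UnburnInv {n : ℕ} (x : Fin n → ℕ) (t : Triple n) (p : ℕ → ℕ) (u : UnburnState n)
    (c : ℕ) : Prop where
  le : c ≤ n
  mem_burning : ∀ v, v ∈ u.burning ↔ v.val ≤ c
  head_le : u.head.val ≤ c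
  todo : ∀ j ∈ u.todo, c ≤ j.val
  burnt_zero : ∀ v w, v ∉ u.burning → w ∉ u.burning → u.burnt.count s(v, w) = 0
  -- A vertex is not left before its children burn, so children still to be lit hang from the path
  -- of the head.
  pending : ∀ w, c < w → w ≤ n → p w ≤ c → Anc p (p w) u.head.val
  children : ∀ j : Fin n, c ≤ j.val → p (j.val + 1) = u.head.val → j ∈ u.todo
  -- Enough unburnt copies of a tree edge are kept for its label, so the scan cannot pass a child of
  -- the head without igniting it.
  room : ∀ w, c < w → w ≤ n →
    u.burnt.count s(vert n (p w), vert n w) + 1 + t.labelAt s(vert n (p w), vert n w) ≤ next x (p w)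

/-! ### Steps of the inverse algorithm. -/

namespace UnburnInv

variable {n : ℕ} {x : Fin n → ℕ} {t : Triple n} {p : ℕ → ℕ} {u : UnburnState n} {c : ℕ}

lemma init (ht : IsTriple x t p) : UnburnInv x t p (unburnInit n) 0 where
  le := Nat.zero_le _
  mem_burning := fun v => by
    simp only [unburnInit, Finset.mem_singleton, Nat.le_zero]
    exact Fin.ext_iff
  head_le := le_rfl
  todo := fun _ _ => Nat.zero_le _
  burnt_zero := fun v w _ _ => by simp [unburnInit]
  pending := fun w _ _ hp => by
    rw [Nat.le_zero.1 hp]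
    exact anc_root ht.rooted.lt _
  children := fun j _ _ => mem_notBurning.2 (by simp)
  room := fun w hw hwn => by
    have := ht.label_lt w hw hwn
    simp only [unburnInit, Multiset.count_zero]
    omega

lemma succ_notMem (H : UnburnInv x t p u c) {j : Fin n} : j.succ ∉ u.burning ↔ c ≤ j.val := by
  rw [H.mem_burning, Fin.val_succ]
  omega

lemma mem_notBurning_iff (H : UnburnInv x t p u c) {j : Fin n} :
    j ∈ notBurning u.burning ↔ c ≤ j.val := by
  rw [mem_notBurning, H.succ_notMem]

lemma weight_eq (H : UnburnInv x t p u c) {j : Fin n} (hj : c ≤ j.val) :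
    (Gx x).weight s(u.head, j.succ) = next x u.head.val := by
  have := H.head_le
  rw [← vert_val u.head, ← vert_succ, Gx_weight x (by omega) j.isLt, vert_val]

lemma available_iff (H : UnburnInv x t p u c) {j : Fin n} (hj : c ≤ j.val) :
    s(u.head, j.succ) ∈ (Gx x).edges - u.burnt ↔
      u.burnt.count s(u.head, j.succ) < next x u.head.val := by
  rw [mem_sub_iff_count_lt, count_edges, H.weight_eq hj]

/-- The condition under which `j` starts to burn. -/
lemma ignites_iff (H : UnburnInv x t p u c) (ht : IsTriple x t p) {j : Fin n} (hj : c ≤ j.val)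
    (hav : s(u.head, j.succ) ∈ (Gx x).edges - u.burnt) :
    (∃ h : s(u.head, j.succ) ∈ t.tree.edgeSet, t.label ⟨s(u.head, j.succ), h⟩ =
      ((Gx x).edges - (u.burnt + {s(u.head, j.succ)})).count s(u.head, j.succ)) ↔
    p (j.val + 1) = u.head.val ∧
      u.burnt.count s(u.head, j.succ) + (1 + t.labelAt s(u.head, j.succ)) = next x u.head.val := by
  have hhead := H.head_le
  rw [H.available_iff hj] at hav
  rw [Multiset.count_sub, count_edges, H.weight_eq hj, Multiset.count_add,
    Multiset.count_singleton_self]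
  have hadj : s(u.head, j.succ) ∈ t.tree.edgeSet ↔ p (j.val + 1) = u.head.val := by
    rw [SimpleGraph.mem_edgeSet, ← ht.rooted.adj_iff (by omega) j.isLt, vert_val, vert_succ]
  rw [← hadj]
  constructor
  · rintro ⟨h, hl⟩
    rw [t.labelAt_of_mem h, hl]
    exact ⟨h, by omega⟩
  · rintro ⟨h, hl⟩
    rw [t.labelAt_of_mem h] at hl
    exact ⟨h, by omega⟩

lemma available_of_child (H : UnburnInv x t p u c) {j : Fin n} (hj : c ≤ j.val)
    (hp : p (j.val + 1) = u.head.val) : s(u.head, j.succ) ∈ (Gx x).edges - u.burnt := by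
  rw [H.available_iff hj]
  have := H.room (j.val + 1) (by omega) j.isLt
  rw [hp, vert_val, vert_succ] at this
  omega

lemma erase (H : UnburnInv x t p u c) {j : Fin n} (hj : j ∈ u.todo)
    (hav : s(u.head, j.succ) ∉ (Gx x).edges - u.burnt) :
    UnburnInv x t p { u with todo := u.todo.erase j } c := by
  refine { H with todo := fun k hk => H.todo k (Finset.mem_of_mem_erase hk), children := ?_ }
  intro k hk hp
  refine Finset.mem_erase.2 ⟨?_, H.children k hk hp⟩
  rintro rfl
  exact hav (H.available_of_child hk hp)

lemma backtrack (H : UnburnInv x t p u c) (ht : IsTriple x t p) (htodo : u.todo = ∅)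
    (h0 : u.head ≠ 0) :
    UnburnInv x t p { u with head := par t.tree u.head, todo := notBurning u.burning } c ∧
      (par t.tree u.head).val = p u.head.val := by
  have hpos : 0 < u.head.val := Fin.pos_of_ne_zero h0
  have hlt := ht.rooted.lt _ hpos
  have hhead := H.head_le
  have hle := H.le
  have hpar : (par t.tree u.head).val = p u.head.val := by
    have := ht.rooted.par_eq hpos (by omega)
    rw [vert_val] at this
    rw [this, val_vert (by omega)]
  refine ⟨{ H with head_le := ?_, todo := ?_, pending := ?_, children := ?_ }, hpar⟩
  · change (par t.tree u.head).val ≤ c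
    omega
  · exact fun j hj => H.mem_notBurning_iff.1 hj
  · intro w hw hwn hp
    change Anc p (p w) (par t.tree u.head).val
    rw [hpar]
    rcases anc_iff.1 (H.pending w hw hwn hp) with heq | h'
    · have := H.children ⟨w - 1, by omega⟩ (by simp only; omega)
        (by simp only [Nat.sub_add_cancel (by omega : 1 ≤ w)]; exact heq)
      simp [htodo] at this
    · exact h'.2
  · exact fun j hj _ => H.mem_notBurning_iff.2 hj

lemma burn (H : UnburnInv x t p u c) (ht : IsTriple x t p) {j : Fin n} (hj : c ≤ j.val)
    (hno : ¬ (p (j.val + 1) = u.head.val ∧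
      u.burnt.count s(u.head, j.succ) + (1 + t.labelAt s(u.head, j.succ)) = next x u.head.val)) :
    UnburnInv x t p { u with
          burnt := u.burnt + {s(u.head, j.succ)}
          chips := Function.update u.chips j (u.chips j + 1) } c := by
  have hheadB : u.head ∈ u.burning := (H.mem_burning _).2 H.head_le
  have hjB := H.succ_notMem.2 hj
  refine { H with burnt_zero := ?_, room := ?_ }
  · intro v w hv hw
    change (u.burnt + {s(u.head, j.succ)}).count s(v, w) = 0
    rw [Multiset.count_add, H.burnt_zero v w hv hw, Multiset.count_singleton,
      if_neg (edge_ne hheadB hv hw)]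
  · intro w hw hwn
    change (u.burnt + {s(u.head, j.succ)}).count _ + 1 + _ ≤ _
    have hroom := H.room w hw hwn
    rw [Multiset.count_add, Multiset.count_singleton]
    split_ifs with heq
    · have hlt := ht.rooted.lt w (by omega)
      have hhead := H.head_le
      have hw' : w = j.val + 1 ∧ p w = u.head.val := by
        rw [Sym2.eq_iff] at heq
        rcases heq with ⟨h1, h2⟩ | ⟨h1, h2⟩
        · have h1 := congrArg Fin.val h1
          have h2 := congrArg Fin.val h2
          rw [val_vert (by omega)] at h1 h2
          exact ⟨h2, h1⟩
        · have h2 := congrArg Fin.val h2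
          rw [val_vert (by omega)] at h2
          omega
      obtain ⟨rfl, hp⟩ := hw'
      rw [hp, vert_val, vert_succ] at hroom ⊢
      -- Since this copy does not ignite, the inequality `room` was strict and leaves space for one
      -- more burnt copy.
      rw [not_and] at hno
      have := hno hp
      omega
    · exact hroom

/-- The next vertex that starts to burn is the vertex `c + 1`. -/
lemma val_eq_of_ignites (H : UnburnInv x t p u c) (ht : IsTriple x t p) {j : Fin n}
    (hj : j ∈ u.todo) (hmax : ∀ k ∈ u.todo, k ≠ j → t.lt k j) (hp : p (j.val + 1) = u.head.val) :
    j.val = c := by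
  have := ht.total
  have hcj := H.todo j hj
  have hhead := H.head_le
  by_contra hne
  have hlt : c < j.val := lt_of_le_of_ne hcj (Ne.symm hne)
  have hcn : c < n := hlt.trans j.isLt
  have hpc := ht.rooted.lt (c + 1) (Nat.succ_pos _)
  have hanc := H.pending (c + 1) (Nat.lt_succ_self _) hcn (by omega)
  -- If `c + 1` is also a child of the head, it is a smaller sibling of `j + 1`, hence larger for ≺,
  -- and the scan would have met it first.
  by_cases heq : p (c + 1) = u.head.val
  · have hmem := H.children ⟨c, hcn⟩ le_rfl heq
    have h1 := hmax _ hmem (fun h' => hne (by rw [← h']))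
    have h2 := ht.sibling ⟨c, hcn⟩ j hlt (heq.trans hp.symm)
    exact asymm h1 h2
  -- Otherwise `p (c + 1)` is the parent of some `i` on the path of the head. As `i < c + 1 < j + 1`
  -- and `j + 1` lies below `i`, the preorder property puts `c + 1` below `i`, against `p (c + 1) =
  -- p i < i`.
  · obtain ⟨i, i0, hi, hpi⟩ := hanc.exists_child heq
    have hih := hi.le ht.rooted.lt
    have hij : Anc p i (j.val + 1) := Anc.step (Nat.succ_pos _) (hp ▸ hi)
    have hic := ht.preorder i (c + 1) (j.val + 1) i0 (by omega) (by omega) j.isLt hij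
    rcases anc_iff.1 hic with h' | ⟨_, h'⟩
    · omega
    · have := h'.le ht.rooted.lt
      have := ht.rooted.lt i i0
      omega

lemma ignite (H : UnburnInv x t p u c) {j : Fin n} (hj : j.val = c)
    (hp : p (j.val + 1) = u.head.val) :
    UnburnInv x t p { u with
          burning := insert j.succ u.burning
          head := j.succ
          todo := notBurning (insert j.succ u.burning) } (c + 1) := by
  subst hj
  have hmem : ∀ v, v ∈ insert j.succ u.burning ↔ v.val ≤ j.val + 1 := by
    intro v
    rw [Finset.mem_insert, H.mem_burning, Fin.ext_iff, Fin.val_succ]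
    omega
  refine
    { le := j.isLt
      mem_burning := hmem
      head_le := le_rfl
      todo := ?_
      burnt_zero := ?_
      pending := ?_
      children := ?_
      room := fun w hw => H.room w (by omega) }
  · intro k hk
    have := mem_notBurning.1 hk
    rw [hmem, Fin.val_succ] at this
    omega
  · intro v w hv hw
    exact H.burnt_zero v w (fun h' => hv (Finset.mem_insert_of_mem h'))
      (fun h' => hw (Finset.mem_insert_of_mem h'))
  · intro w hw hwn hpw
    change Anc p (p w) (j.val + 1)
    rcases Nat.le_succ_iff.1 hpw with h' | h'
    · exact Anc.step (Nat.succ_pos _) (hp ▸ H.pending w (by omega) hwn h')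
    · exact h' ▸ Anc.refl
  · intro k hk _
    rw [mem_notBurning, hmem, Fin.val_succ]
    omega

/-- One step of the inverse algorithm. -/
lemma exists_step (H : UnburnInv x t p u c) (ht : IsTriple x t p) :
    (unburnStep (Gx x) t u = none ∧ c = n) ∨
    ∃ u' c', unburnStep (Gx x) t u = some u' ∧ UnburnInv x t p u' c' ∧
      ((∀ j, u.chips j ≤ u'.chips j) ∧
        ∀ j : Fin n, j.succ ∈ u.burning → j.succ ∈ u'.burning ∧ u'.chips j = u.chips j) ∧
      toLex (n - c', toLex (((Gx x).edges - u'.burnt).card, toLex (u'.head.val, u'.todo.card))) <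
        toLex (n - c, toLex (((Gx x).edges - u.burnt).card, toLex (u.head.val, u.todo.card))) := by
  have := ht.total
  rcases hm : maxOf t.lt u.todo with _ | j
  · have htodo := maxOf_eq_none.1 hm
    by_cases h0 : u.head = 0
    · refine Or.inl ⟨by simp [unburnStep, hm, h0], ?_⟩
      by_contra hne
      have hcn : c < n := lt_of_le_of_ne H.le hne
      have hpc := ht.rooted.lt (c + 1) (Nat.succ_pos _)
      have hanc := H.pending (c + 1) (Nat.lt_succ_self _) hcn (by omega)
      rw [h0] at hanc
      have := H.children ⟨c, hcn⟩ le_rfl (by rw [h0]; exact hanc.eq_zero)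
      simp [htodo] at this
    · right
      obtain ⟨H', hpar⟩ := H.backtrack ht htodo h0
      refine ⟨_, c, ?_, H', ⟨fun j => le_rfl, fun j hj => ⟨hj, rfl⟩⟩, ?_⟩
      · simp [unburnStep, hm, h0]
      · refine Prod.Lex.toLex_lt_toLex.2 (Or.inr ⟨rfl, Prod.Lex.toLex_lt_toLex.2 (Or.inr ⟨rfl,
          Prod.Lex.toLex_lt_toLex.2 (Or.inl ?_)⟩)⟩)
        change (par t.tree u.head).val < u.head.val
        rw [hpar]
        exact ht.rooted.lt _ (Fin.pos_of_ne_zero h0)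
  · right
    obtain ⟨hj, hmax⟩ := maxOf_eq_some.1 hm
    have hcj := H.todo j hj
    by_cases hav : s(u.head, j.succ) ∈ (Gx x).edges - u.burnt
    · by_cases hign : ∃ h : s(u.head, j.succ) ∈ t.tree.edgeSet, t.label ⟨s(u.head, j.succ), h⟩ =
          ((Gx x).edges - (u.burnt + {s(u.head, j.succ)})).count s(u.head, j.succ)
      · have hp := ((H.ignites_iff ht hcj hav).1 hign).1
        refine ⟨_, _, ?_, H.ignite (H.val_eq_of_ignites ht hj hmax hp) hp,
          ⟨fun k => le_rfl, fun k hk => ⟨Finset.mem_insert_of_mem hk, rfl⟩⟩, ?_⟩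
        · simp only [unburnStep, hm, if_pos hav, if_pos hign]
        · refine Prod.Lex.toLex_lt_toLex.2 (Or.inl ?_)
          have := j.isLt
          change n - (c + 1) < n - c
          omega
      · refine ⟨_, c, ?_, H.burn ht hcj (fun h' => hign ((H.ignites_iff ht hcj hav).2 h')),
          ⟨fun k => ?_, fun k hk => ⟨hk, ?_⟩⟩, ?_⟩
        · simp only [unburnStep, hm, if_pos hav, if_neg hign]
        · change u.chips k ≤ Function.update u.chips j (u.chips j + 1) k
          by_cases hkj : k = j
          · rw [hkj, Function.update_self]
            exact Nat.le_succ _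
          · rw [Function.update_of_ne hkj]
        · refine Function.update_of_ne ?_ _ _
          rintro rfl
          exact H.succ_notMem.2 hcj hk
        · exact Prod.Lex.toLex_lt_toLex.2 (Or.inr ⟨rfl, Prod.Lex.toLex_lt_toLex.2
            (Or.inl (card_sub_add_singleton_lt hav))⟩)
    · refine ⟨_, c, ?_, H.erase hj hav, ⟨fun k => le_rfl, fun k hk => ⟨hk, rfl⟩⟩, ?_⟩
      · simp only [unburnStep, hm, if_neg hav]
      · exact Prod.Lex.toLex_lt_toLex.2 (Or.inr ⟨rfl, Prod.Lex.toLex_lt_toLex.2 (Or.inr ⟨rfl,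
          Prod.Lex.toLex_lt_toLex.2 (Or.inr ⟨rfl, Finset.card_erase_lt_of_mem hj⟩)⟩)⟩)

/-- During a run, chips are added, but not to burning vertices. -/
lemma chips_le (H : UnburnInv x t p u c) (ht : IsTriple x t p) {v : UnburnState n}
    (huv : StateTransition.Reaches (unburnStep (Gx x) t) u v) :
    (∀ j, u.chips j ≤ v.chips j) ∧ ∀ j : Fin n, j.succ ∈ u.burning → v.chips j = u.chips j := by
  induction huv using Relation.ReflTransGen.head_induction_on generalizing c with
  | refl => exact ⟨fun j => le_rfl, fun j _ => rfl⟩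
  | @head u w huw _ ih =>
    have huw : unburnStep (Gx x) t u = some w := huw
    rcases H.exists_step ht with h | ⟨u', c', h, H', ⟨h1, h2⟩, _⟩
    · rw [h.1] at huw
      exact absurd huw (by simp)
    · rw [h, Option.some.injEq] at huw
      subst huw
      obtain ⟨h3, h4⟩ := ih H'
      exact ⟨fun j => (h1 j).trans (h3 j), fun j hj => (h4 j (h2 j hj).1).trans (h2 j hj).2⟩

end UnburnInv

lemma unburn_terminates {n : ℕ} {x : Fin n → ℕ} {t : Triple n} {p : ℕ → ℕ} (ht : IsTriple x t p) :
    ∃ u, StateTransition.Reaches (unburnStep (Gx x) t) (unburnInit n) u ∧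
      unburnStep (Gx x) t u = none := by
  obtain ⟨u, _, h1, h2, _⟩ := exists_halting (unburnStep (Gx x) t)
    (fun u (c : ℕ) => UnburnInv x t p u c)
    (fun u c => toLex (n - c, toLex (((Gx x).edges - u.burnt).card,
      toLex (u.head.val, u.todo.card))))
    (fun u c H => by
      rcases H.exists_step ht with h | ⟨u', c', h, H', _, hlt⟩
      · exact Or.inl h.1
      · exact Or.inr ⟨u', c', h, H', hlt⟩)
    (unburnInit n) 0 (UnburnInv.init ht)
  exact ⟨u, h1, h2⟩

/-! ### The burning algorithm mirrors its inverse -/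

/-- The state `s` of the burning algorithm on the input `α` corresponds to the state `u` of the
inverse algorithm on the input `t`; the vertex `j` of the former is the vertex `τ j` of the latter. -/
structure Mirror {n : ℕ} (x α : Fin n → ℕ) (t : Triple n) (p : ℕ → ℕ) (τ : Equiv.Perm (Fin n))
    (s : BurnState n) (u : UnburnState n) : Prop where
  -- The parent function of `t` can be used from the start, since beyond `p k < k` only its values
  -- up to `counter` matter.
  burnInv : BurnInv x α s u.head.val p
  unburnInv : UnburnInv x t p u s.counter
  perm : ∀ j, (τ j).val + 1 ≤ s.counter → s.perm ((τ j).val + 1) = j.succ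
  todo : ∀ j, τ j ∈ u.todo ↔ j ∈ s.todo
  chips : ∀ j, s.chips j + u.chips (τ j) = α j
  burnt : ∀ a ≤ s.counter, ∀ j : Fin n, s.counter ≤ (τ j).val →
    u.burnt.count s(vert n a, (τ j).succ) = s.burntCount a j
  label : ∀ k, 0 < k → k ≤ s.counter →
    s.label s(s.perm (p k), s.perm k) = t.labelAt s(vert n (p k), vert n k)

namespace Mirror

variable {n : ℕ} {x α : Fin n → ℕ} {t : Triple n} {p : ℕ → ℕ} {τ : Equiv.Perm (Fin n)}
  {s : BurnState n} {u : UnburnState n}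

lemma init (ht : IsTriple x t p) : Mirror x α t p τ (burnInit x α) (unburnInit n) where
  burnInv := BurnInv.init x α ht.rooted.lt
  unburnInv := UnburnInv.init ht
  perm := fun j hj => by simp [burnInit] at hj
  todo := fun j => by simp [burnInit, unburnInit, mem_notBurning]
  chips := fun j => by simp [burnInit, unburnInit]
  burnt := fun a _ j _ => by simp [burnInit, unburnInit, BurnState.burntCount]
  label := fun k k0 hk => by simp only [burnInit] at hk; omega

lemma succ_notMem (M : Mirror x α t p τ s u) {j : Fin n} :
    j.succ ∉ s.burning ↔ s.counter ≤ (τ j).val := by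
  rw [M.burnInv.mem_burning]
  constructor
  · intro h
    by_contra hlt
    exact h ⟨(τ j).val + 1, by omega, M.perm j (by omega)⟩
  · rintro hle ⟨k, hk, hkj⟩
    have k0 : k ≠ 0 := by
      rintro rfl
      rw [M.burnInv.rooted.zero] at hkj
      exact Fin.succ_ne_zero _ hkj.symm
    have hkn := hk.trans M.burnInv.counter_le
    have h1 := M.perm (τ.symm ⟨k - 1, by omega⟩) (by simp only [Equiv.apply_symm_apply]; omega)
    simp only [Equiv.apply_symm_apply, Nat.sub_add_cancel (Nat.pos_of_ne_zero k0)] at h1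
    rw [hkj] at h1
    rw [Fin.succ_injective _ h1, Equiv.apply_symm_apply] at hle
    simp only at hle
    omega

lemma mem_notBurning_iff (M : Mirror x α t p τ s u) {j : Fin n} :
    τ j ∈ notBurning u.burning ↔ j ∈ notBurning s.burning := by
  rw [M.unburnInv.mem_notBurning_iff, mem_notBurning, M.succ_notMem]

/-- Corresponding states have corresponding successors, provided that the inverse algorithm ends
with the chips of `α`. -/
lemma step (M : Mirror x α t p τ s u) (ht : IsTriple x t p) (hτ : ∀ i j, t.lt (τ i) (τ j) ↔ i < j)
    {v : UnburnState n} (hv : unburnStep (Gx x) t v = none)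
    (huv : StateTransition.Reaches (unburnStep (Gx x) t) u v) (hα : ∀ j, α j = v.chips (τ j)) :
    (burnStep x s = none ∧ s.counter = n) ∨
    ∃ s' u', burnStep x s = some s' ∧ unburnStep (Gx x) t u = some u' ∧ Mirror x α t p τ s' u' := by
  have := ht.total
  have hBI := M.burnInv
  have hUI := M.unburnInv
  rcases hm : maxOf (· < ·) s.todo with _ | j
  · have htodo := maxOf_eq_none.1 hm
    have htodo' : u.todo = ∅ := by
      refine Finset.eq_empty_of_forall_notMem fun k hk => ?_
      obtain ⟨j, rfl⟩ := τ.surjective k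
      rw [M.todo, htodo] at hk
      exact absurd hk (Finset.notMem_empty _)
    have hm' : maxOf t.lt u.todo = none := maxOf_eq_none.2 htodo'
    by_cases h0 : u.head = 0
    · left
      have hnone : unburnStep (Gx x) t u = none := by simp [unburnStep, hm', h0]
      refine ⟨by simp [burnStep, hm, hBI.head, h0, hBI.rooted.zero], ?_⟩
      rcases hUI.exists_step ht with h | ⟨u', _, h, _⟩
      · exact h.2
      · rw [hnone] at h
        exact absurd h (by simp)
    · right
      obtain ⟨hUI', hpar⟩ := hUI.backtrack ht htodo' h0
      have hhead : s.head ≠ 0 := by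
        rw [hBI.head, ← hBI.rooted.zero]
        exact fun h' => h0 (Fin.ext (hBI.rooted.inj _ hBI.h_le 0 (Nat.zero_le _) h'))
      have hBI' := hBI.backtrack htodo (Fin.pos_of_ne_zero h0)
      rw [← hpar] at hBI'
      have hs' : burnStep x s = some { s with
          head := par s.tree s.head, todo := notBurning s.burning } := by
        simp [burnStep, hm, hhead]
      have hu' : unburnStep (Gx x) t u = some { u with
          head := par t.tree u.head, todo := notBurning u.burning } := by
        simp [unburnStep, hm', h0]
      exact ⟨_, _, hs', hu', ⟨hBI', hUI', M.perm, fun j => M.mem_notBurning_iff, M.chips, M.burnt,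
        M.label⟩⟩
  · right
    obtain ⟨hj, hmax⟩ := maxOf_eq_some.1 hm
    have hj' : τ j ∈ u.todo := (M.todo j).2 hj
    have hmax' : ∀ k ∈ u.todo, k ≠ τ j → t.lt k (τ j) := by
      intro k hk hkj
      obtain ⟨k, rfl⟩ := τ.surjective k
      exact (hτ k j).2 (hmax k ((M.todo k).1 hk) fun h' => hkj (h' ▸ rfl))
    have hm' : maxOf t.lt u.todo = some (τ j) := maxOf_eq_some.2 ⟨hj', hmax'⟩
    have hcj := hUI.todo _ hj'
    have hjB := hBI.todo j hj
    have hburnt : u.burnt.count s(u.head, (τ j).succ) = s.burntCount u.head.val j := by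
      rw [← M.burnt _ hUI.head_le j hcj, vert_val]
    have hav : s(u.head, (τ j).succ) ∈ (Gx x).edges - u.burnt ↔
        s(s.head, j.succ) ∈ s.edges - s.burnt := by
      rw [hUI.available_iff hcj, hBI.available_iff hjB, hburnt]
    by_cases hs : s(s.head, j.succ) ∈ s.edges - s.burnt
    · have hu := hav.2 hs
      by_cases hign : ∃ h : s(u.head, (τ j).succ) ∈ t.tree.edgeSet,
          t.label ⟨s(u.head, (τ j).succ), h⟩ =
          ((Gx x).edges - (u.burnt + {s(u.head, (τ j).succ)})).count s(u.head, (τ j).succ)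
      · obtain ⟨hp, hlab⟩ := (hUI.ignites_iff ht hcj hu).1 hign
        have hc := hUI.val_eq_of_ignites ht hj' hmax' hp
        have hUI' := hUI.ignite hc hp
        have hstep : unburnStep (Gx x) t u = some { u with
            burning := insert (τ j).succ u.burning
            head := (τ j).succ
            todo := notBurning (insert (τ j).succ u.burning) } := by
          simp only [unburnStep, hm', if_pos hu, if_pos hign]
        -- The chips of `τ j` are final from now on, hence equal to `α j`: none remain at `j`, which
        -- ignites too.
        have hfin := (hUI'.chips_le ht (reaches_of_step huv hv hstep)).2 (τ j)
          (Finset.mem_insert_self _ _)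
        have hchips : s.chips j = 0 := by
          have h1 := M.chips j
          rw [hα j, hfin] at h1
          simpa using h1
        have hBI' := hBI.ignite hj hmax hs hchips (hc ▸ hp)
        have hBI'' : BurnInv x α (VectorParking.ignite x s j) ((τ j).succ).val p := by
          rw [Fin.val_succ, hc]
          exact hBI'
        have hperm := fun a ha => BurnInv.ignite_perm_of_le (x := x) s j (a := a) ha
        have hperm' := BurnInv.ignite_perm_self (x := x) s j
        refine ⟨_, _, ?_, hstep, ⟨hBI'', hUI', ?_, ?_, M.chips, ?_, ?_⟩⟩
        · simp only [burnStep, hm, if_pos hs, hchips]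
          rfl
        · intro k hk
          rcases Nat.le_succ_iff.1 hk with hk | hk
          · rw [hperm _ hk, M.perm k hk]
          · have hkj : τ k = τ j := Fin.ext (by omega)
            rw [hkj, hc, hperm', τ.injective hkj]
        · intro k
          change τ k ∈ notBurning (insert (τ j).succ u.burning) ↔
            k ∈ notBurning (insert j.succ s.burning)
          rw [mem_notBurning, mem_notBurning, Finset.mem_insert, Finset.mem_insert, not_or, not_or,
            ← mem_notBurning, ← mem_notBurning, M.mem_notBurning_iff, Fin.succ_inj, Fin.succ_inj,
            τ.injective.eq_iff]
        · intro a ha k hk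
          change s.counter + 1 ≤ (τ k).val at hk
          have hkB := M.succ_notMem.2 ((Nat.le_succ _).trans hk)
          rcases Nat.le_succ_iff.1 ha with ha | rfl
          · rw [BurnState.burntCount, hperm a ha]
            exact M.burnt a ha k (by omega)
          · rw [BurnState.burntCount, Nat.succ_eq_add_one, hperm', ← hc, vert_succ]
            exact (hUI.burnt_zero _ _ (hUI.succ_notMem.2 hcj) (hUI.succ_notMem.2 (by omega))).trans
              (hBI.burnt_zero _ _ hjB hkB).symm
        · intro k k0 hk
          rcases Nat.le_succ_iff.1 hk with hk | rfl
          · have hpk := hBI.parent_le k0 hk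
            rw [hperm k hk, hperm _ hpk,
              BurnInv.ignite_label_of_mem hjB (hBI.perm_mem hpk) (hBI.perm_mem hk)]
            exact M.label k k0 hk
          · have hself := hBI.ignite_label_self hjB hs
            rw [Nat.succ_eq_add_one, hperm', ← hc, hp, hperm _ hUI.head_le, vert_val, vert_succ]
            rw [hburnt] at hlab
            omega
      · have hno : ¬ (p ((τ j).val + 1) = u.head.val ∧ _) := fun h' =>
          hign ((hUI.ignites_iff ht hcj hu).2 h')
        have hUI' := hUI.burn ht hcj hno
        have hstep : unburnStep (Gx x) t u = some { u with
            burnt := u.burnt + {s(u.head, (τ j).succ)}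
            chips := Function.update u.chips (τ j) (u.chips (τ j) + 1) } := by
          simp only [unburnStep, hm', if_pos hu, if_neg hign]
        -- A chip is added now and never removed, so the final value `α j` exceeds the current count
        -- and `j` still has a chip to spend.
        have hfin := (hUI'.chips_le ht (reaches_of_step huv hv hstep)).1 (τ j)
        have hchips : 1 ≤ s.chips j := by
          have h1 := M.chips j
          simp only [Function.update_self] at hfin
          rw [hα j] at h1
          omega
        refine ⟨_, _, ?_, hstep, ⟨hBI.burn hj hmax hs hchips, hUI', M.perm, M.todo, ?_, ?_, M.label⟩⟩
        · simp only [burnStep, hm, if_pos hs, if_pos hchips]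
        · intro k
          change Function.update s.chips j (s.chips j - 1) k +
            Function.update u.chips (τ j) (u.chips (τ j) + 1) (τ k) = α k
          rw [← M.chips k]
          by_cases hkj : k = j
          · subst hkj
            rw [Function.update_self, Function.update_self]
            omega
          · rw [Function.update_of_ne hkj, Function.update_of_ne (τ.injective.ne hkj)]
        · intro a ha k hk
          change (u.burnt + {s(u.head, (τ j).succ)}).count s(vert n a, (τ k).succ) =
            (s.burnt + {s(s.head, j.succ)}).count s(s.perm a, k.succ)
          have hkB := M.succ_notMem.2 hk
          have han := ha.trans hBI.counter_le
          have hhead := hUI.head_le.trans hBI.counter_le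
          rw [Multiset.count_add, Multiset.count_add, M.burnt a ha k hk, BurnState.burntCount]
          congr 1
          rw [Multiset.count_singleton, Multiset.count_singleton]
          refine if_congr ?_ rfl rfl
          rw [edge_eq_iff ((hUI.mem_burning (vert n a)).2 (by rwa [val_vert han]))
            (hUI.succ_notMem.2 hcj), edge_eq_iff (hBI.perm_mem ha) hjB, Fin.succ_inj, Fin.succ_inj,
            τ.injective.eq_iff, hBI.head]
          refine and_congr ⟨fun h' => ?_, fun h' => ?_⟩ Iff.rfl
          · rw [← h', val_vert han]
          · rw [hBI.rooted.inj a ha _ hBI.h_le h', vert_val]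
    · have hu := fun h' => hs (hav.1 h')
      have hs' : burnStep x s = some { s with todo := s.todo.erase j } := by
        simp only [burnStep, hm, if_neg hs]
      have hu' : unburnStep (Gx x) t u = some { u with todo := u.todo.erase (τ j) } := by
        simp only [unburnStep, hm', if_neg hu]
      refine ⟨_, _, hs', hu', ⟨hBI.erase hj hs, hUI.erase hj' hu, M.perm, fun k => ?_, M.chips,
        M.burnt, M.label⟩⟩
      change τ k ∈ u.todo.erase (τ j) ↔ k ∈ s.todo.erase j
      rw [Finset.mem_erase, Finset.mem_erase, M.todo, τ.injective.ne_iff]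

/-- The simulation is followed along the burning run; by `step`, this run can halt only when all `n`
vertices burn. -/
lemma final (M : Mirror x α t p τ s u) (ht : IsTriple x t p) (hτ : ∀ i j, t.lt (τ i) (τ j) ↔ i < j)
    {v : UnburnState n} (hv : unburnStep (Gx x) t v = none)
    (huv : StateTransition.Reaches (unburnStep (Gx x) t) u v) (hα : ∀ j, α j = v.chips (τ j))
    {f : BurnState n} (hf : burnStep x f = none) (hsf : StateTransition.Reaches (burnStep x) s f) :
    ∃ w, Mirror x α t p τ f w ∧ f.counter = n := by
  induction hsf using Relation.ReflTransGen.head_induction_on generalizing u with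
  | refl =>
    rcases M.step ht hτ hv huv hα with h | ⟨s', _, h, _⟩
    · exact ⟨u, M, h.2⟩
    · rw [hf] at h
      exact absurd h (by simp)
  | @head s r hsr _ ih =>
    have hsr : burnStep x s = some r := hsr
    rcases M.step ht hτ hv huv hα with h | ⟨s', u', h, hu, M'⟩
    · rw [h.1] at hsr
      exact absurd hsr (by simp)
    · rw [h, Option.some.injEq] at hsr
      subst hsr
      exact ih M' (reaches_of_step huv hv hu)

lemma output_eq (M : Mirror x α t p τ s u) (ht : IsTriple x t p)
    (hτ : ∀ i j, t.lt (τ i) (τ j) ↔ i < j) (hc : s.counter = n) : burnOutput s = t := by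
  have hroot := M.burnInv.rooted_output hc
  refine Triple.ext_of ?_ ?_ ?_
  · ext a b
    rw [hroot.adj, ht.rooted.adj]
  · intro e he
    obtain ⟨j, hj⟩ := hroot.parentEdge_bijective.2 ⟨e, he⟩
    have hj := Subtype.ext_iff.1 hj
    simp only at hj
    rw [← hj, parentEdge, ← vert_succ, M.burnInv.labelAt_output hc (Nat.succ_pos _) j.isLt]
    exact M.label _ (Nat.succ_pos _) (by omega)
  · intro i j
    have hg : ∀ i : Fin n, s.perm (i.val + 1) = (τ.symm i).succ := by
      intro i
      have := M.perm (τ.symm i) (by rw [Equiv.apply_symm_apply]; omega)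
      rwa [Equiv.apply_symm_apply] at this
    rw [BurnInv.output_lt_iff hc hg, ← hτ, Equiv.apply_symm_apply, Equiv.apply_symm_apply]

end Mirror

/-! ### The bijection -/

lemma exists_vectorDFS {n : ℕ} {x α : Fin n → ℕ} (hα : IsParking x α) :
    ∃ t ∈ Triples x, vectorDFS x α = Part.some t ∧ Encodes x α t := by
  obtain ⟨s, p, h1, h2, H, htodo⟩ := burn_terminates x α
  have hc := H.counter_eq_of_isParking htodo hα
  refine ⟨burnOutput s, H.output_mem_triples hc, ?_, H.encodes_output hc⟩
  rw [vectorDFS, eval_eq_some h1 h2, Part.map_some]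

/-- The burning algorithm terminates on every input, so the simulation can be run before `α` is
known to be parking; this then follows from the counting identity. -/
lemma exists_vectorInverse {n : ℕ} {x : Fin n → ℕ} {t : Triple n} (ht : t ∈ Triples x) :
    ∃ α ∈ PF x, vectorInverse x t = Part.some α ∧ vectorDFS x α = Part.some t ∧
      Encodes x α t := by
  obtain ⟨p, ht⟩ := exists_isTriple ht
  have := ht.total
  obtain ⟨v, huv, hv⟩ := unburn_terminates ht
  have hτ := sortPerm_lt_iff t.lt
  set α := v.chips ∘ sortPerm t.lt with hα
  obtain ⟨s, _, h1, h2, _, _⟩ := burn_terminates x α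
  obtain ⟨w, M, hc⟩ := (Mirror.init ht).final ht hτ hv huv (fun j => by rw [hα]; rfl) h2 h1
  have henc := M.burnInv.encodes_output hc
  have hout := M.output_eq ht hτ hc
  rw [hout] at henc
  refine ⟨α, henc.isParking, ?_, ?_, henc⟩
  · rw [vectorInverse, multigraphInverse, eval_eq_some huv hv, Part.map_some, Part.map_some]
  · rw [vectorDFS, eval_eq_some h1 h2, Part.map_some, hout]

end VectorParking

theorem mainTheorem2 {n : ℕ} (x : Fin n → ℕ) :
    ∃ ψ : VectorParking.PF x ≃ VectorParking.Triples x,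
      (∀ α : VectorParking.PF x,
        VectorParking.vectorDFS x α.val = Part.some (ψ α).val) ∧
      (∀ α : VectorParking.PF x,
        VectorParking.rsum x α.val =
          (VectorParking.kappa (VectorParking.Gx x) (ψ α).val.tree (ψ α).val.lt : ℤ) +
            ((ψ α).val.labelSum : ℤ)) ∧
      (∀ t : VectorParking.Triples x,
        VectorParking.vectorInverse x t.val = Part.some (ψ.symm t).val) := by
  choose f hf hfeval hfenc using fun α : VectorParking.PF x => VectorParking.exists_vectorDFS α.2
  choose g hg hgeval hgdfs hgenc using
    fun t : VectorParking.Triples x => VectorParking.exists_vectorInverse t.2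
  refine ⟨⟨fun α => ⟨f α, hf α⟩, fun t => ⟨g t, hg t⟩, fun α => Subtype.ext ?_,
    fun t => Subtype.ext ?_⟩, hfeval, fun α => ?_, hgeval⟩
  -- Both functions are encoded by the triple `f α`, so no simulation in the other direction is
  -- needed.
  · exact (hgenc ⟨f α, hf α⟩).unique (hfenc α)
  · exact Part.some_inj.1 ((hfeval ⟨g t, hg t⟩).symm.trans (hgdfs t))
  · obtain ⟨p, hp⟩ := VectorParking.exists_isTriple (hf α)
    exact (hfenc α).rsum_eq hp.rooted
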